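/- Let $k\ge 1$ and let $\Lambda$ be a nonempty, finite, strongly connected $k$-graph with adjacency matrices $A_1,\dots,A_k$, and suppose that $A=A_1\cdots A_k$ is irreducible. Let $\rho_i$ be the spectral radius of $A_i$, write $\rho(\Lambda)^n=\rho_1^{n_1}\cdots\rho_k^{n_k}$ for $n\in\mathbb N^k$, let $x^\Lambda$ be the positive vector with $\sum_v x^\Lambda_v=1$ and $A_ix^\Lambda=\rho_ix^\Lambda$ for all $i$, and let $M$ be the Borel probability measure on the infinite path space $\Lambda^\infty$ with $M([\lambda])=\rho(\Lambda)^{-d(\lambda)}x^\Lambda_{s(\lambda)}$ for all $\lambda\in\Lambda$ (both exist). Let $\mathcal B_\Lambda$ be the stationary $k$-Bratteli diagram of $\Lambda$: all levels $\mathcal V_n$ ($n\ge0$) are copies of $\Lambda^0$, and the edges from $\mathcal V_{n}$ to $\mathcal V_{n-1}$ are the edges of $\Lambda$ of color $i$, where $i\equiv n \pmod k$, $1\le i\le k$. Its infinite path space is identified with $\Lambda^\infty$. Let $F\mathcal B_\Lambda$ be the set of its finite paths $\gamma$ with range in $\mathcal V_0$ (vertices of $\mathcal V_0$ are the paths of length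 $|\gamma|=0$), let $[\gamma]\subseteq\Lambda^\infty$ be the cylinder set of $\gamma$, and let $\mathrm{ext}_1(\gamma)$ be the set of pairs $(e,e')$ of edges with $e\ne e'$ and $r(e)=r(e')=s(\gamma)$. For $\delta\in(0,1)$ and $|\gamma|=qk+t$, $0\le t<k$, let $$w_\delta(\gamma)=\left(\rho_1^{q+1}\cdots\rho_t^{q+1}\rho_{t+1}^q\cdots\rho_k^q\right)^{-1/\delta}x^\Lambda_{s(\gamma)}.$$ Let $d(x,y)$ be $0$ if $x=y$, be $1$ if $x,y\in\Lambda^\infty$ have different ranges, and otherwise be the value of $w_\delta$ at the longest common initial segment of $x$ and $y$ in $\mathcal B_\Lambda$. Suppose that $w_\delta$ is a weight on $\mathcal B_\Lambda$ (that is, $w_\delta>0$, $\sum_{v\in\mathcal V_0}w_\delta(v)\le1$, $\sup_{|\gamma|=n}w_\delta(\gamma)\to0$ as $n\to\infty$, and $w_\delta$ is strictly smaller on proper extensions of a path) and that $w_\delta(\gamma)=\operatorname{diam}[\gamma]$ for the metric $d$, for every $\gamma\in F\mathcal B_\Lambda$. In $L^2(\Lambda^\infty,M)$ put, for $n\in\mathbb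 N$ and $\gamma\in F\mathcal B_\Lambda$, $$\mathscr V_n=\operatorname{span}\{\chi_{[\lambda]}:d(\lambda)=(n,\dots,n)\},\qquad \mathcal W_n=\mathscr V_{n+1}\cap\mathscr V_n^\perp,\qquad E_{-1}=\operatorname{span}\{\chi_{\Lambda^\infty}\},$$ $$E_0=\operatorname{span}\Big\{\tfrac{1}{M([v])}\chi_{[v]}-\tfrac1{M([v'])}\chi_{[v']}:v\ne v'\in\mathcal V_0\Big\},\qquad E_\gamma=\operatorname{span}\Big\{\tfrac{1}{M([\gamma e])}\chi_{[\gamma e]}-\tfrac1{M([\gamma e'])}\chi_{[\gamma e']}:(e,e')\in\mathrm{ext}_1(\gamma)\Big\}.$$ For $s\in\mathbb R$ let $\Delta_s$ be the Laplace–Beltrami operator on the span of the functions $\chi_{[\gamma]}$, given by $$\langle f,\Delta_s g\rangle=Q_s(f,g)=\tfrac12\int\operatorname{Tr}\big(|D|^{-s}[D,\pi_\tau(f)]^*[D,\pi_\tau(g)]\big)\,dN(\tau),$$ where $D=\bigoplus_\gamma\frac1{\operatorname{diam}[\gamma]}\begin{pmatrix}0&1\\1&0\end{pmatrix}$ and $\pi_\tau(f)=\bigoplus_\gamma\begin{pmatrix}f(\tau_+(\gamma))&0\\0&f(\tau_-(\gamma))\end{pmatrix}$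 on $\ell^2(F\mathcal B_\Lambda,\mathbb C^2)$, and $N=\prod_\gamma N_\gamma$ is the product probability measure on the choice functions $\tau=(\tau_+,\tau_-)$, with $N_\gamma$ the normalized restriction of $M\times M$ to $\{(x,y)\in[\gamma]\times[\gamma]:d(x,y)=\operatorname{diam}[\gamma]\}$. Then the eigenspaces of the operators $\Delta_s$ refine the wavelet decomposition $$L^2(\Lambda^\infty,M)=\mathscr V_0\oplus\bigoplus_{n\in\mathbb N}\mathcal W_n$$ (an orthogonal direct sum of Hilbert spaces). Precisely: for every $s\in\mathbb R$, each of the spaces $E_{-1}$, $E_0$ and $E_\gamma$ ($\gamma\in F\mathcal B_\Lambda$) consists of eigenvectors of $\Delta_s$ for a single eigenvalue (together with $0$); the spaces $E_\gamma$ are pairwise orthogonal; and $$\mathscr V_0=E_{-1}\oplus E_0,\qquad \mathcal W_n=\operatorname{span}\{E_\gamma:\gamma\in F\mathcal B_\Lambda,\ nk\le|\gamma|<(n+1)k\}\quad(n\in\mathbb N),$$ where the first sum is orthogonal. -/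

import Mathlib

open MeasureTheory Filter Topology

universe u

/-! ## Bratteli diagrams, weights and ultrametrics -/

/-- A Bratteli diagram. `V n` is the (finite) set of vertices at level `n`, and `E n p q` is the
(finite) set of edges with range `p` at level `n` and source `q` at level `n + 1`. -/
structure BratteliDiagram where
  V : ℕ → Type u
  E : (n : ℕ) → V n → V (n + 1) → Type u
  finite_V : ∀ n, Finite (V n)
  finite_E : ∀ n p q, Finite (E n p q)

namespace BratteliDiagram

/-- `B.Path n p`: finite paths `γ₁ ⋯ γₙ` with range at level `0` and source `p` at level `n`;
a path of length `0` is a vertex of level `0`. -/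
inductive Path (B : BratteliDiagram.{u}) : (n : ℕ) → B.V n → Type u
  | vertex (v : B.V 0) : Path B 0 v
  | snoc {n : ℕ} {p : B.V n} {q : B.V (n + 1)} (γ : Path B n p) (e : B.E n p q) :
      Path B (n + 1) q

/-- The set `Fℬ` of all finite paths with range at level `0`. -/
structure FinPath (B : BratteliDiagram.{u}) where
  len : ℕ
  src : B.V len
  path : B.Path len src

/-- A vertex of level `0`, as a path of length `0`. -/
def FinPath.vertex {B : BratteliDiagram.{u}} (v : B.V 0) : B.FinPath := ⟨0, v, .vertex v⟩

/-- The path `γ e`. -/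
def FinPath.snoc {B : BratteliDiagram.{u}} (γ : B.FinPath) {q : B.V (γ.len + 1)}
    (e : B.E γ.len γ.src q) : B.FinPath := ⟨γ.len + 1, q, γ.path.snoc e⟩

/-- The edges `e` with `r(e) = s(γ)`, each given together with its source. -/
abbrev FinPath.Ext {B : BratteliDiagram.{u}} (γ : B.FinPath) : Type u :=
  Σ q : B.V (γ.len + 1), B.E γ.len γ.src q

/-- `η.IsSubpath γ`: `γ` is obtained from `η` by appending finitely many (maybe no) edges. -/
inductive FinPath.IsSubpath {B : BratteliDiagram.{u}} (η : B.FinPath) : B.FinPath → Prop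
  | refl : IsSubpath η η
  | snoc {γ : B.FinPath} {q : B.V (γ.len + 1)} (h : IsSubpath η γ) (e : B.E γ.len γ.src q) :
      IsSubpath η (γ.snoc e)

/-- The space `X_ℬ` of infinite paths. -/
structure InfPath (B : BratteliDiagram.{u}) where
  vert : ∀ n, B.V n
  edge : ∀ n, B.E n (vert n) (vert (n + 1))

/-- The first `n` edges of an infinite path. -/
def InfPath.initial {B : BratteliDiagram.{u}} (x : B.InfPath) : (n : ℕ) → B.Path n (x.vert n)
  | 0 => .vertex (x.vert 0)
  | n + 1 => (x.initial n).snoc (x.edge n)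

/-- The sub-path of length `n` of an infinite path. -/
def InfPath.trunc {B : BratteliDiagram.{u}} (x : B.InfPath) (n : ℕ) : B.FinPath :=
  ⟨n, x.vert n, x.initial n⟩

/-- The cylinder set `[γ]` of infinite paths with initial segment `γ`. -/
def cylinder {B : BratteliDiagram.{u}} (γ : B.FinPath) : Set B.InfPath :=
  {x | x.trunc γ.len = γ}

/-- A weight on a Bratteli diagram. -/
structure IsWeight {B : BratteliDiagram.{u}} (w : B.FinPath → ℝ) : Prop where
  pos : ∀ γ, 0 < w γ
  sum_le : ∑ᶠ v : B.V 0, w (.vertex v) ≤ 1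
  tendsto : Tendsto (fun n : ℕ => sSup (w '' {γ | γ.len = n})) atTop (𝓝 0)
  strict : ∀ η γ : B.FinPath, η.IsSubpath γ → η ≠ γ → w γ < w η

open Classical in
/-- The ultrametric `d_w`: it is `1` if `x` and `y` have no common sub-path (not even a common
range), `0` if `x = y`, and `w (x ∧ y)` otherwise, where `x ∧ y` is the longest common sub-path. -/
noncomputable def dist {B : BratteliDiagram.{u}} (w : B.FinPath → ℝ) (x y : B.InfPath) : ℝ :=
  if x.trunc 0 ≠ y.trunc 0 then 1
  else if x = y then 0
  else w (x.trunc (sSup {n | x.trunc n = y.trunc n}))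

/-- The diameter of the cylinder set `[γ]` for `d_w`. -/
noncomputable def diam {B : BratteliDiagram.{u}} (w : B.FinPath → ℝ) (γ : B.FinPath) : ℝ :=
  sSup {d | ∃ x ∈ cylinder γ, ∃ y ∈ cylinder γ, d = dist w x y}

end BratteliDiagram

/-! ## Higher-rank graphs -/

/-- A `k`-graph, in the arrows-only picture: a countable small category with objects `Obj`,
morphisms `Mor`, range `r`, source `s`, identities `one` and composition `comp f g = f g` (defined
when `s f = r g`), with a degree functor to `ℕ^k` that has the unique factorization property. -/
structure KGraph (k : ℕ) where
  Obj : Type u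
  Mor : Type u
  r : Mor → Obj
  s : Mor → Obj
  one : Obj → Mor
  comp : (f g : Mor) → s f = r g → Mor
  r_one : ∀ v, r (one v) = v
  s_one : ∀ v, s (one v) = v
  r_comp : ∀ f g h, r (comp f g h) = r f
  s_comp : ∀ f g h, s (comp f g h) = s g
  one_comp : ∀ f, comp (one (r f)) f (s_one _) = f
  comp_one : ∀ f, comp f (one (s f)) (r_one _).symm = f
  assoc : ∀ (f g h : Mor) (hfg : s f = r g) (hgh : s g = r h),
    comp (comp f g hfg) h ((s_comp f g hfg).trans hgh)
      = comp f (comp g h hgh) (hfg.trans (r_comp g h hgh).symm)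
  countable : Countable Mor
  deg : Mor → (Fin k → ℕ)
  deg_one : ∀ v, deg (one v) = 0
  deg_comp : ∀ f g h, deg (comp f g h) = deg f + deg g
  factorization : ∀ (f : Mor) (m n : Fin k → ℕ), deg f = m + n →
    ∃! p : Mor × Mor, deg p.1 = m ∧ deg p.2 = n ∧ ∃ h : s p.1 = r p.2, comp p.1 p.2 h = f

namespace KGraph

variable {k : ℕ}

/-- `Λ` is finite: each set `Λ^n` is finite. -/
class IsFinite (Λ : KGraph.{u} k) : Prop where
  finite_deg : ∀ n : Fin k → ℕ, {f : Λ.Mor | Λ.deg f = n}.Finite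

/-- `Λ` is strongly connected: `v Λ w` is nonempty for all vertices `v`, `w`. -/
def StronglyConnected (Λ : KGraph.{u} k) : Prop :=
  ∀ v w : Λ.Obj, ∃ f : Λ.Mor, Λ.r f = v ∧ Λ.s f = w

instance instFiniteObj (Λ : KGraph.{u} k) [h : Λ.IsFinite] : Finite Λ.Obj := by
  have h0 : Finite {f : Λ.Mor | Λ.deg f = 0} := (h.finite_deg 0).to_subtype
  refine Finite.of_injective
    (fun v => (⟨Λ.one v, Λ.deg_one v⟩ : {f : Λ.Mor | Λ.deg f = 0})) fun v w hvw => ?_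
  have h1 : Λ.one v = Λ.one w := congrArg Subtype.val hvw
  rw [← Λ.r_one v, h1, Λ.r_one]

noncomputable instance instFintypeObj (Λ : KGraph.{u} k) [Λ.IsFinite] : Fintype Λ.Obj :=
  Fintype.ofFinite _

noncomputable instance instDecidableEqObj (Λ : KGraph.{u} k) : DecidableEq Λ.Obj :=
  Classical.decEq _

/-- The edges of color `i` with range `v` and source `w`. -/
abbrev ColorEdge (Λ : KGraph.{u} k) (i : Fin k) (v w : Λ.Obj) : Type u :=
  {f : Λ.Mor // Λ.deg f = Pi.single i 1 ∧ Λ.r f = v ∧ Λ.s f = w}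

/-- The adjacency matrix `A_i` (with real entries). -/
noncomputable def adj (Λ : KGraph.{u} k) (i : Fin k) : Matrix Λ.Obj Λ.Obj ℝ :=
  fun v w => (Nat.card (Λ.ColorEdge i v w) : ℝ)

/-- The product `A = A_1 ⋯ A_k`. -/
noncomputable def adjProd (Λ : KGraph.{u} k) [Λ.IsFinite] : Matrix Λ.Obj Λ.Obj ℝ :=
  (List.ofFn Λ.adj).prod

/-- The spectral radius `ρ_i` of `A_i`. -/
noncomputable def rho (Λ : KGraph.{u} k) [Λ.IsFinite] (i : Fin k) : ℝ :=
  (spectralRadius ℂ ((Λ.adj i).map (fun a : ℝ => (a : ℂ)))).toReal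

/-- `ρ(Λ)^n` for `n ∈ ℕ^k`. -/
noncomputable def rhoPow (Λ : KGraph.{u} k) [Λ.IsFinite] (n : Fin k → ℕ) : ℝ :=
  ∏ i, Λ.rho i ^ n i

/-- `x` is a positive common eigenvector of the `A_i`, with eigenvalues `ρ_i` and total mass
`1`. -/
structure IsPerronFrobenius (Λ : KGraph.{u} k) [Λ.IsFinite] (x : Λ.Obj → ℝ) : Prop where
  pos : ∀ v, 0 < x v
  sum_eq : ∑ v, x v = 1
  eigen : ∀ i, (Λ.adj i).mulVec x = Λ.rho i • x

open Classical in
/-- The Perron-Frobenius eigenvector `x^Λ`: the vector with `IsPerronFrobenius`, which exists and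
is unique if `Λ` is finite, nonempty and strongly connected. -/
noncomputable def perron (Λ : KGraph.{u} k) [Λ.IsFinite] : Λ.Obj → ℝ :=
  if h : ∃ x, Λ.IsPerronFrobenius x then h.choose else 0

/-- Infinite paths of `Λ`: the `k`-graph morphisms `Ω_k → Λ`; the morphism `(m, n)` of `Ω_k`
(where `m ≤ n`) has range `m`, source `n` and degree `n - m`. -/
structure InfPath (Λ : KGraph.{u} k) where
  obj : (Fin k → ℕ) → Λ.Obj
  mor : (m n : Fin k → ℕ) → m ≤ n → Λ.Mor
  r_mor : ∀ m n h, Λ.r (mor m n h) = obj m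
  s_mor : ∀ m n h, Λ.s (mor m n h) = obj n
  mor_self : ∀ m, mor m m le_rfl = Λ.one (obj m)
  mor_comp : ∀ m n p (h : m ≤ n) (h' : n ≤ p),
    Λ.comp (mor m n h) (mor n p h') ((s_mor m n h).trans (r_mor n p h').symm)
      = mor m p (h.trans h')
  deg_mor : ∀ m n h, Λ.deg (mor m n h) = n - m

/-- The cylinder set `[f] = {x | x(0, d(f)) = f}` of a morphism `f`. -/
def cylinder {Λ : KGraph.{u} k} (f : Λ.Mor) : Set Λ.InfPath :=
  {x | x.mor 0 (Λ.deg f) zero_le = f}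

instance instTopInfPath (Λ : KGraph.{u} k) : TopologicalSpace Λ.InfPath :=
  TopologicalSpace.generateFrom (Set.range (cylinder (Λ := Λ)))

instance instMeasInfPath (Λ : KGraph.{u} k) : MeasurableSpace Λ.InfPath := borel _

instance instBorelInfPath (Λ : KGraph.{u} k) : BorelSpace Λ.InfPath := ⟨rfl⟩

theorem isOpen_cylinder {Λ : KGraph.{u} k} (f : Λ.Mor) : IsOpen (cylinder f) :=
  TopologicalSpace.isOpen_generateFrom_of_mem ⟨f, rfl⟩

/-- `M` is a Borel probability measure with `M([f]) = ρ(Λ)^{-d(f)} x^Λ_{s(f)}` for all `f`. -/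
structure IsPathMeasure (Λ : KGraph.{u} k) [Λ.IsFinite] (M : Measure Λ.InfPath) : Prop where
  prob : IsProbabilityMeasure M
  apply_cylinder : ∀ f : Λ.Mor,
    M (cylinder f) = ENNReal.ofReal ((Λ.rhoPow (Λ.deg f))⁻¹ * Λ.perron (Λ.s f))

open Classical in
/-- The measure `M` on `Λ^∞`: the measure with `IsPathMeasure`, which exists and is unique if `Λ`
is finite, nonempty and strongly connected. -/
noncomputable def measure (Λ : KGraph.{u} k) [Λ.IsFinite] : Measure Λ.InfPath :=
  if h : ∃ M, Λ.IsPathMeasure M then h.choose else 0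

instance instFiniteMeasure (Λ : KGraph.{u} k) [Λ.IsFinite] : IsFiniteMeasure Λ.measure := by
  unfold measure
  split_ifs with h
  · have := h.choose_spec.prob
    infer_instance
  · infer_instance

/-! ## The stationary `k`-Bratteli diagram of a `k`-graph -/

/-- The stationary `k`-Bratteli diagram `ℬ_Λ`: every level is a copy of the vertex set of `Λ`, and
the edges from level `n + 1` to level `n` are the edges of `Λ` of color `n mod k`, where colors
are numbered from `0`. In particular there are `A_i(p, q)` of them from `q` to `p`. -/
def bratteli (Λ : KGraph.{u} k) [NeZero k] [hΛ : Λ.IsFinite] : BratteliDiagram.{u} where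
  V _ := Λ.Obj
  E n p q := Λ.ColorEdge (Fin.ofNat k n) p q
  finite_V _ := inferInstance
  finite_E n _ _ := ((hΛ.finite_deg (Pi.single (Fin.ofNat k n) 1)).subset
    (fun _ hf => hf.1)).to_subtype

/-- For `n = q k + t` with `0 ≤ t < k`, the degree `(q+1, …, q+1, q, …, q)` with `t` entries
`q + 1`. -/
def rainbow (k n : ℕ) : Fin k → ℕ := fun i => n / k + if i.val < n % k then 1 else 0

theorem rainbow_succ (k n : ℕ) [NeZero k] :
    rainbow k (n + 1) = rainbow k n + Pi.single (Fin.ofNat k n) 1 := by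
  have hk : 0 < k := NeZero.pos k
  funext i
  have hi := i.isLt
  have hlt : n % k < k := Nat.mod_lt n hk
  have hdm := Nat.div_add_mod n k
  have hs : (Pi.single (Fin.ofNat k n) 1 : Fin k → ℕ) i = if i.val = n % k then 1 else 0 := by
    simp [Pi.single_apply, Fin.ext_iff, Fin.ofNat]
  simp only [rainbow, Pi.add_apply, hs]
  by_cases h : n % k + 1 = k
  · have hn : n + 1 = k * (n / k + 1) := by rw [Nat.mul_add]; omega
    have h1 : (n + 1) / k = n / k + 1 := by rw [hn, Nat.mul_div_cancel_left _ hk]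
    have h2 : (n + 1) % k = 0 := by rw [hn, Nat.mul_mod_right]
    rw [h1, h2]
    split_ifs <;> omega
  · have hn : n + 1 = (n % k + 1) + k * (n / k) := by omega
    have h1 : (n + 1) / k = n / k := by
      rw [hn, Nat.add_mul_div_left _ _ hk, Nat.div_eq_of_lt (by omega)]; simp
    have h2 : (n + 1) % k = n % k + 1 := by
      rw [hn, Nat.add_mul_mod_self_left, Nat.mod_eq_of_lt (by omega)]
    rw [h1, h2]
    split_ifs <;> omega

theorem rainbow_le_succ (k n : ℕ) [NeZero k] : rainbow k n ≤ rainbow k (n + 1) := by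
  rw [rainbow_succ]
  exact le_add_of_nonneg_right zero_le

/-- The identification of `Λ^∞` with the infinite path space of `ℬ_Λ`: it sends `x` to the sequence
of edges `f_1^1 f_2^1 ⋯ f_k^1 f_1^2 ⋯` of colors `1, 2, …, k, 1, 2, …` whose product is `x`. -/
def InfPath.toBratteli {Λ : KGraph.{u} k} [NeZero k] [Λ.IsFinite] (x : Λ.InfPath) :
    Λ.bratteli.InfPath where
  vert n := x.obj (rainbow k n)
  edge n := ⟨x.mor (rainbow k n) (rainbow k (n + 1)) (rainbow_le_succ k n),
    by rw [x.deg_mor, rainbow_succ, add_tsub_cancel_left], x.r_mor _ _ _, x.s_mor _ _ _⟩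

/-- The cylinder set `[γ] ⊆ Λ^∞` of a finite path `γ` of `ℬ_Λ`. -/
def pathCylinder {Λ : KGraph.{u} k} [NeZero k] [Λ.IsFinite] (γ : Λ.bratteli.FinPath) :
    Set Λ.InfPath :=
  InfPath.toBratteli ⁻¹' BratteliDiagram.cylinder γ

/-- The weight `w_δ` on `ℬ_Λ`. -/
noncomputable def weight (Λ : KGraph.{u} k) [NeZero k] [Λ.IsFinite] (δ : ℝ)
    (γ : Λ.bratteli.FinPath) : ℝ :=
  Λ.rhoPow (rainbow k γ.len) ^ (-1 / δ) * Λ.perron γ.src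

/-- `(ℬ_Λ, w_δ)` is a weighted Bratteli diagram with `w_δ(γ) = diam [γ]` for all `γ`. -/
structure WeightEqDiam (Λ : KGraph.{u} k) [NeZero k] [Λ.IsFinite] (δ : ℝ) : Prop where
  isWeight : BratteliDiagram.IsWeight (Λ.weight δ)
  eq_diam : ∀ γ : Λ.bratteli.FinPath, Λ.weight δ γ = BratteliDiagram.diam (Λ.weight δ) γ

/-! ### Measurability of cylinder sets -/

theorem InfPath.mor_eq_of_eq {Λ : KGraph.{u} k} {x y : Λ.InfPath} {p : Fin k → ℕ}
    (h : x.mor 0 p zero_le = y.mor 0 p zero_le) {m n : Fin k → ℕ} (hmn : m ≤ n)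
    (hnp : n ≤ p) : x.mor m n hmn = y.mor m n hmn := by
  have key : ∀ (a b c : Fin k → ℕ) (hab : a ≤ b) (hbc : b ≤ c),
      x.mor a c (hab.trans hbc) = y.mor a c (hab.trans hbc) →
      x.mor a b hab = y.mor a b hab ∧ x.mor b c hbc = y.mor b c hbc := by
    intro a b c hab hbc hac
    have hd : Λ.deg (x.mor a c (hab.trans hbc)) = (b - a) + (c - b) := by
      rw [x.deg_mor]
      funext i
      have h1 : a i ≤ b i := hab i
      have h2 : b i ≤ c i := hbc i
      simp only [Pi.sub_apply, Pi.add_apply]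
      omega
    have hu := (Λ.factorization _ _ _ hd).unique
      (y₁ := (x.mor a b hab, x.mor b c hbc)) (y₂ := (y.mor a b hab, y.mor b c hbc))
      ⟨x.deg_mor _ _ _, x.deg_mor _ _ _, _, x.mor_comp _ _ _ hab hbc⟩
      ⟨y.deg_mor _ _ _, y.deg_mor _ _ _, _, (y.mor_comp _ _ _ hab hbc).trans hac.symm⟩
    exact ⟨congrArg Prod.fst hu, congrArg Prod.snd hu⟩
  have h1 := (key 0 n p zero_le hnp h).1
  exact (key 0 m n zero_le hmn h1).2

theorem InfPath.trunc_eq_of_eq {Λ : KGraph.{u} k} [NeZero k] [Λ.IsFinite] {x y : Λ.InfPath}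
    (n : ℕ) (h : x.mor 0 (rainbow k n) zero_le = y.mor 0 (rainbow k n) zero_le) :
    x.toBratteli.trunc n = y.toBratteli.trunc n := by
  have aux : ∀ (n : ℕ) (p p' q q' : Λ.Obj) (γ : Λ.bratteli.Path n p) (γ' : Λ.bratteli.Path n p')
      (e : Λ.bratteli.E n p q) (e' : Λ.bratteli.E n p' q'),
      (⟨n, p, γ⟩ : Λ.bratteli.FinPath) = ⟨n, p', γ'⟩ → e.val = e'.val →
      (⟨n + 1, q, γ.snoc e⟩ : Λ.bratteli.FinPath) = ⟨n + 1, q', γ'.snoc e'⟩ := by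
    rintro n p p' q q' γ γ' ⟨e, he⟩ ⟨e', he'⟩ hγ hee
    cases hγ
    have hee' : e = e' := hee
    subst hee'
    obtain rfl : q = q' := he.2.2.symm.trans he'.2.2
    rfl
  induction n with
  | zero =>
    have h0 : x.obj (rainbow k 0) = y.obj (rainbow k 0) := by
      rw [← x.s_mor 0 _ zero_le, h, y.s_mor]
    change (⟨0, x.obj (rainbow k 0), .vertex _⟩ : Λ.bratteli.FinPath)
      = ⟨0, y.obj (rainbow k 0), .vertex _⟩
    rw [h0]
  | succ n ih =>
    exact aux n _ _ _ _ _ _ _ _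
      (ih (InfPath.mor_eq_of_eq h zero_le (rainbow_le_succ k n)))
      (InfPath.mor_eq_of_eq h (rainbow_le_succ k n) le_rfl)

theorem isOpen_pathCylinder {Λ : KGraph.{u} k} [NeZero k] [Λ.IsFinite]
    (γ : Λ.bratteli.FinPath) : IsOpen (pathCylinder γ) := by
  rw [isOpen_iff_forall_mem_open]
  intro x hx
  have hd : Λ.deg (x.mor 0 (rainbow k γ.len) zero_le) = rainbow k γ.len := by
    rw [x.deg_mor, tsub_zero]
  refine ⟨cylinder (x.mor 0 (rainbow k γ.len) zero_le), fun y hy => ?_, isOpen_cylinder _, ?_⟩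
  · have hy' : y.mor 0 (rainbow k γ.len) zero_le = x.mor 0 (rainbow k γ.len) zero_le := by
      have hy2 : y.mor 0 (Λ.deg (x.mor 0 (rainbow k γ.len) zero_le)) zero_le
          = x.mor 0 (rainbow k γ.len) zero_le := hy
      simpa only [hd] using hy2
    exact (InfPath.trunc_eq_of_eq γ.len hy').trans hx
  · change x.mor 0 (Λ.deg (x.mor 0 (rainbow k γ.len) zero_le)) zero_le = _
    simp only [hd]

/-! ## Subspaces of `L²(Λ^∞, M)` -/

/-- The Hilbert space `L²(Λ^∞, M)`. -/
abbrev L2 (Λ : KGraph.{u} k) [Λ.IsFinite] : Type u := Lp ℂ 2 Λ.measure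

/-- The characteristic function of a measurable set, as an element of `L²(Λ^∞, M)`. -/
noncomputable def chi {Λ : KGraph.{u} k} [Λ.IsFinite] {S : Set Λ.InfPath}
    (hS : MeasurableSet S) : Λ.L2 :=
  indicatorConstLp 2 hS (measure_ne_top Λ.measure S) (1 : ℂ)

/-- `χ_[f]` for a morphism `f` of `Λ`. -/
noncomputable def chiMor {Λ : KGraph.{u} k} [Λ.IsFinite] (f : Λ.Mor) : Λ.L2 :=
  chi (isOpen_cylinder f).measurableSet

/-- `χ_[γ]` for a finite path `γ` of `ℬ_Λ`. -/
noncomputable def chiPath {Λ : KGraph.{u} k} [NeZero k] [Λ.IsFinite]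
    (γ : Λ.bratteli.FinPath) : Λ.L2 :=
  chi (isOpen_pathCylinder γ).measurableSet

/-- `M([γ])⁻¹ χ_[γ]`. -/
noncomputable def chiNormalized {Λ : KGraph.{u} k} [NeZero k] [Λ.IsFinite]
    (γ : Λ.bratteli.FinPath) : Λ.L2 :=
  ((Λ.measure.real (pathCylinder γ) : ℝ) : ℂ)⁻¹ • chiPath γ

/-- The space `𝒱_n`. -/
noncomputable def scalingSpace (Λ : KGraph.{u} k) [Λ.IsFinite] (n : ℕ) : Submodule ℂ Λ.L2 :=
  Submodule.span ℂ {φ | ∃ f : Λ.Mor, (Λ.deg f = fun _ => n) ∧ φ = chiMor f}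

/-- The wavelet space `𝒲_n = 𝒱_{n+1} ∩ 𝒱_n^⊥`. -/
noncomputable def waveletSpace (Λ : KGraph.{u} k) [Λ.IsFinite] (n : ℕ) : Submodule ℂ Λ.L2 :=
  Λ.scalingSpace (n + 1) ⊓ (Λ.scalingSpace n)ᗮ

/-- The space `E_{-1}` of constants. -/
noncomputable def eigenspaceConst (Λ : KGraph.{u} k) [Λ.IsFinite] : Submodule ℂ Λ.L2 :=
  Submodule.span ℂ {chi (MeasurableSet.univ (α := Λ.InfPath))}

/-- The space `E_0`. -/
noncomputable def eigenspaceRoot (Λ : KGraph.{u} k) [NeZero k] [Λ.IsFinite] :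
    Submodule ℂ Λ.L2 :=
  Submodule.span ℂ {φ | ∃ v v' : Λ.bratteli.V 0, v ≠ v' ∧
    φ = chiNormalized (.vertex v) - chiNormalized (.vertex v')}

/-- The space `E_γ` of a finite path `γ`. -/
noncomputable def eigenspacePath (Λ : KGraph.{u} k) [NeZero k] [Λ.IsFinite]
    (γ : Λ.bratteli.FinPath) : Submodule ℂ Λ.L2 :=
  Submodule.span ℂ {φ | ∃ e e' : γ.Ext, e ≠ e' ∧
    φ = chiNormalized (γ.snoc e.2) - chiNormalized (γ.snoc e'.2)}

/-! ## The Laplace-Beltrami operators -/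

section LaplaceBeltrami

variable (Λ : KGraph.{u} k) [NeZero k] [Λ.IsFinite] (δ : ℝ)

/-- The possible values `(τ₊(γ), τ₋(γ))` at `γ` of a choice function: the pairs of points of `[γ]`
whose distance is the diameter of `[γ]`. The set of choice functions is the product of these
sets. -/
def choicePairs (γ : Λ.bratteli.FinPath) : Set (Λ.InfPath × Λ.InfPath) :=
  {p | p.1 ∈ pathCylinder γ ∧ p.2 ∈ pathCylinder γ ∧
    BratteliDiagram.dist (Λ.weight δ) p.1.toBratteli p.2.toBratteli
      = BratteliDiagram.diam (Λ.weight δ) γ}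

/-- The probability measure `N_γ`: the restriction of `M × M` to the possible values of choice
functions at `γ`, normalized. -/
noncomputable def choiceMeasureAt (γ : Λ.bratteli.FinPath) :
    Measure (Λ.InfPath × Λ.InfPath) :=
  ProbabilityTheory.cond (Λ.measure.prod Λ.measure) (Λ.choicePairs δ γ)

open Classical in
/-- The product probability measure `N = ∏_γ N_γ` on the space of choice functions. (Every `N_γ` is
a probability measure as soon as `WeightEqDiam` holds.) -/
noncomputable def choiceMeasure :
    Measure (Λ.bratteli.FinPath → Λ.InfPath × Λ.InfPath) :=
  if h : ∀ γ, IsProbabilityMeasure (Λ.choiceMeasureAt δ γ) then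
    haveI := h
    Measure.infinitePi (Λ.choiceMeasureAt δ)
  else 0

/-- The `γ`-block of the Dirac operator `D` on `ℓ²(Fℬ_Λ, ℂ²)`. -/
noncomputable def diracBlock (γ : Λ.bratteli.FinPath) : Matrix (Fin 2) (Fin 2) ℂ :=
  ((1 / BratteliDiagram.diam (Λ.weight δ) γ : ℝ) : ℂ) • !![0, 1; 1, 0]

/-- The `γ`-block of `|D|^{-s}`. -/
noncomputable def absDiracBlock (s : ℝ) (γ : Λ.bratteli.FinPath) : Matrix (Fin 2) (Fin 2) ℂ :=
  ((BratteliDiagram.diam (Λ.weight δ) γ ^ s : ℝ) : ℂ) • 1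

/-- The `γ`-block of the representation `π_τ(f)`. -/
def reprBlock (τ : Λ.bratteli.FinPath → Λ.InfPath × Λ.InfPath) (f : Λ.InfPath → ℂ)
    (γ : Λ.bratteli.FinPath) : Matrix (Fin 2) (Fin 2) ℂ :=
  !![f (τ γ).1, 0; 0, f (τ γ).2]

/-- The `γ`-block of the commutator `[D, π_τ(f)]`. -/
noncomputable def commutatorBlock (τ : Λ.bratteli.FinPath → Λ.InfPath × Λ.InfPath)
    (f : Λ.InfPath → ℂ) (γ : Λ.bratteli.FinPath) : Matrix (Fin 2) (Fin 2) ℂ :=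
  Λ.diracBlock δ γ * Λ.reprBlock τ f γ - Λ.reprBlock τ f γ * Λ.diracBlock δ γ

/-- The Dirichlet form
`Q_s(f, g) = 1/2 ∫ Tr(|D|^{-s} [D, π_τ(f)]^* [D, π_τ(g)]) dN(τ)`.
All operators under the trace are block diagonal, so the trace is the sum of the traces of the
blocks. It is used only for `f, g` in `formDomain`, where all but finitely many blocks of the
commutators vanish. -/
noncomputable def dirichletForm (s : ℝ) (f g : Λ.InfPath → ℂ) : ℂ :=
  1 / 2 * ∫ τ, ∑' γ : Λ.bratteli.FinPath, (Λ.absDiracBlock δ s γ *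
    (Λ.commutatorBlock δ τ f γ).conjTranspose * Λ.commutatorBlock δ τ g γ).trace
      ∂(Λ.choiceMeasure δ)

/-- The domain of `Q_s`: the span of the characteristic functions of the cylinder sets. -/
def formDomain : Submodule ℂ (Λ.InfPath → ℂ) :=
  Submodule.span ℂ {f | ∃ γ : Λ.bratteli.FinPath, f = (pathCylinder γ).indicator 1}

/-- The graph of the Laplace-Beltrami operator `Δ_s` on the (dense) span of the characteristic
functions of cylinder sets: `φ` belongs to that span, and `Δ_s φ = ψ`, that is,
`⟨g, ψ⟩ = Q_s(g, φ)` for all `g` in the span. -/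
def LaplaceBeltrami (s : ℝ) (φ ψ : Λ.L2) : Prop :=
  ∃ f ∈ Λ.formDomain, φ =ᵐ[Λ.measure] f ∧
    ∀ g ∈ Λ.formDomain, ∫ x, (starRingEnd ℂ) (g x) * ψ x ∂Λ.measure = Λ.dirichletForm δ s g f

/-- Every element of `E` is mapped by `Δ_s` to its multiple by one common eigenvalue. -/
def ConsistsOfEigenvectors (s : ℝ) (E : Submodule ℂ Λ.L2) : Prop :=
  ∃ c : ℝ, ∀ φ ∈ E, Λ.LaplaceBeltrami δ s φ ((c : ℂ) • φ)

end LaplaceBeltrami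

end KGraph

/-!
The vector `x^Λ` comes from the Perron–Frobenius theorem for the irreducible matrix `A`: its
eigenvector is unique up to scaling, and every `A_i` commutes with `A`, so it is an eigenvector of
every `A_i`. The relations `A_i x^Λ = ρ_i x^Λ` say that the prescribed values of `M` on the
cylinder sets `[γ]` of the diagram are additive; dividing, they are transition probabilities, and
`M` is the law of the random path that chooses its edges independently with these probabilities.

The span of the `χ_[γ e]`, over all extensions `e` of `γ`, is the orthogonal sum of `ℂ χ_[γ]` and
`E_γ`. So passing from the paths of length `m` to those of length `m + 1` adds the `E_γ` with
`|γ| = m`; summation over `n k ≤ m < (n + 1) k` gives `𝒲_n`.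

The blocks of the Dirichlet form are integrals of `conj (g x - g y) (f x - f y)` over pairs of
points in distinct cylinder sets `[γ e]`, `[γ e']`. Expanding the product shows that each block is a
difference of covariances: the one of `f` and `g` on `[γ]` minus those on the `[γ e]`. If `f` is
supported in some `[η]`, has mean zero and is constant on the `[η e]`, then each of these
covariances is zero or a multiple of `⟨g, f⟩`, hence so is the Dirichlet form, a finite sum of
blocks.
-/

namespace PerronFrobenius

open Matrix

variable {n : Type*} [Fintype n]

theorem mulVec_pos {B : Matrix n n ℝ} (hB : ∀ i j, 0 < B i j) {z : n → ℝ} (hz : ∀ i, 0 ≤ z i)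
    (hz0 : z ≠ 0) (i : n) : 0 < (B *ᵥ z) i := by
  obtain ⟨j, hj⟩ := Function.ne_iff.1 hz0
  exact Finset.sum_pos' (fun a _ => mul_nonneg (hB i a).le (hz a))
    ⟨j, Finset.mem_univ j, mul_pos (hB i j) ((hz j).lt_of_ne' hj)⟩

theorem inv_sum_smul_mem_stdSimplex {y : n → ℝ} (hy : ∀ i, 0 ≤ y i) (hy0 : ∑ i, y i ≠ 0) :
    (∑ i, y i)⁻¹ • y ∈ stdSimplex ℝ n := by
  refine ⟨fun i => mul_nonneg (inv_nonneg.2 (Finset.sum_nonneg fun j _ => hy j)) (hy i), ?_⟩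
  simp only [Pi.smul_apply, smul_eq_mul, ← Finset.mul_sum]
  exact inv_mul_cancel₀ hy0

/-- The vectors `x` with `r x ≤ A x` entrywise. The Perron eigenvalue is the largest `r` for which a
nonzero nonnegative vector satisfies this (Collatz–Wielandt). -/
def subeigenvectors (A : Matrix n n ℝ) (r : ℝ) : Set (n → ℝ) :=
  {x | ∀ i, r * x i ≤ (A *ᵥ x) i}

theorem smul_mem_subeigenvectors {A : Matrix n n ℝ} {r c : ℝ} (hc : 0 ≤ c) {x : n → ℝ}
    (hx : x ∈ subeigenvectors A r) : c • x ∈ subeigenvectors A r := fun i => by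
  simpa only [mulVec_smul, Pi.smul_apply, smul_eq_mul, mul_left_comm]
    using mul_le_mul_of_nonneg_left (hx i) hc

theorem le_sum_of_mem_subeigenvectors {A : Matrix n n ℝ} (hA : ∀ i j, 0 ≤ A i j) {r : ℝ}
    {x : n → ℝ} (hx : x ∈ stdSimplex ℝ n) (hr : x ∈ subeigenvectors A r) :
    r ≤ ∑ i, ∑ j, A i j :=
  calc r = ∑ i, r * x i := by rw [← Finset.mul_sum, hx.2, mul_one]
    _ ≤ ∑ i, (A *ᵥ x) i := Finset.sum_le_sum fun i _ => hr i
    _ ≤ ∑ i, ∑ j, A i j := Finset.sum_le_sum fun i _ => Finset.sum_le_sum fun j _ =>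
      mul_le_of_le_one_right (hA i j)
        (hx.2 ▸ Finset.single_le_sum (fun a _ => hx.1 a) (Finset.mem_univ j))

theorem exists_gt_subeigenvector {B : Matrix n n ℝ} (hB : ∀ i j, 0 < B i j) {x : n → ℝ} {r : ℝ}
    (hx : x ∈ stdSimplex ℝ n) (hr : x ∈ subeigenvectors B r) (hne : B *ᵥ x ≠ r • x) :
    ∃ r' > r, ∃ y ∈ stdSimplex ℝ n, y ∈ subeigenvectors B r' := by
  have hx0 : x ≠ 0 := by
    rintro rfl
    simpa using hx.2
  have : Nonempty n := (Function.ne_iff.1 hx0).nonempty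
  have hy : ∀ i, 0 < (B *ᵥ x) i := mulVec_pos hB hx.1 hx0
  have hgain : ∀ i, 0 < (B *ᵥ (B *ᵥ x - r • x)) i :=
    mulVec_pos hB (fun i => sub_nonneg.2 (hr i)) (sub_ne_zero.2 hne)
  obtain ⟨w, hw⟩ := Finite.exists_min fun i => (B *ᵥ (B *ᵥ x - r • x)) i / (B *ᵥ x) i
  set ε := (B *ᵥ (B *ᵥ x - r • x)) w / (B *ᵥ x) w
  have himproved : B *ᵥ x ∈ subeigenvectors B (r + ε) := fun i => by
    have h := (le_div_iff₀ (hy i)).1 (hw i)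
    simp only [mulVec_sub, mulVec_smul, Pi.sub_apply, Pi.smul_apply, smul_eq_mul] at h
    linarith
  have hsum : 0 < ∑ i, (B *ᵥ x) i := Finset.sum_pos (fun i _ => hy i) Finset.univ_nonempty
  exact ⟨r + ε, lt_add_of_pos_right r (div_pos (hgain w) (hy w)), _,
    inv_sum_smul_mem_stdSimplex (fun i => (hy i).le) hsum.ne',
    smul_mem_subeigenvectors (inv_nonneg.2 hsum.le) himproved⟩

theorem exists_isMaxOn_subeigenvectors [Nonempty n] {A : Matrix n n ℝ} (hA : ∀ i j, 0 ≤ A i j) :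
    ∃ x ∈ stdSimplex ℝ n, ∃ r : ℝ, 0 ≤ r ∧ x ∈ subeigenvectors A r ∧
      ∀ r', ∀ y ∈ stdSimplex ℝ n, y ∈ subeigenvectors A r' → r' ≤ r := by
  classical
  let K : Set ((n → ℝ) × ℝ) := (stdSimplex ℝ n ×ˢ Set.Icc 0 (∑ i, ∑ j, A i j)) ∩
    {p | p.1 ∈ subeigenvectors A p.2}
  have hK : IsCompact K := by
    refine ((isCompact_stdSimplex ℝ n).prod isCompact_Icc).inter_right ?_
    have hKi : {p : (n → ℝ) × ℝ | p.1 ∈ subeigenvectors A p.2}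
        = ⋂ i, {p | p.2 * p.1 i ≤ ∑ j, A i j * p.1 j} := by
      ext p
      simp [subeigenvectors, mulVec, dotProduct]
    exact hKi ▸ isClosed_iInter fun i => isClosed_le (by fun_prop) (by fun_prop)
  have hK0 : K.Nonempty := by
    obtain ⟨i⟩ := ‹Nonempty n›
    refine ⟨(Pi.single i 1, 0), ⟨single_mem_stdSimplex ℝ i, le_rfl, ?_⟩, fun j => ?_⟩
    · exact Finset.sum_nonneg fun i _ => Finset.sum_nonneg fun j _ => hA i j
    · simpa using hA j i
  obtain ⟨⟨x, r⟩, ⟨⟨hx, hr⟩, hxr⟩, hmax⟩ := hK.exists_isMaxOn hK0 continuous_snd.continuousOn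
  refine ⟨x, hx, r, hr.1, hxr, fun r' y hy hyr => ?_⟩
  by_contra! hlt
  exact hlt.not_ge (hmax (show (y, r') ∈ K from
    ⟨⟨hy, hr.1.trans hlt.le, le_sum_of_mem_subeigenvectors hA hy hyr⟩, hyr⟩))

theorem exists_pos_eigenvector [Nonempty n] {B : Matrix n n ℝ} (hB : ∀ i j, 0 < B i j) :
    ∃ (x : n → ℝ) (r : ℝ), (∀ i, 0 < x i) ∧ ∑ i, x i = 1 ∧ B *ᵥ x = r • x := by
  obtain ⟨x, hx, r, hr0, hr, hmax⟩ := exists_isMaxOn_subeigenvectors fun i j => (hB i j).le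
  have hBx : B *ᵥ x = r • x := by
    by_contra hne
    obtain ⟨r', hr', y, hy, hyr⟩ := exists_gt_subeigenvector hB hx hr hne
    exact (hmax r' y hy hyr).not_gt hr'
  refine ⟨x, r, fun i => pos_of_mul_pos_right ?_ hr0, hx.2, hBx⟩
  have hx0 : x ≠ 0 := by
    rintro rfl
    simpa using hx.2
  simpa only [hBx, Pi.smul_apply, smul_eq_mul] using mulVec_pos hB hx.1 hx0 i

theorem eq_smul_of_mulVec_eq_smul [Nonempty n] {B : Matrix n n ℝ} (hB : ∀ i j, 0 < B i j)
    {x y : n → ℝ} {r : ℝ} (hx : ∀ i, 0 < x i) (hBx : B *ᵥ x = r • x) (hBy : B *ᵥ y = r • y) :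
    ∃ c : ℝ, y = c • x := by
  -- Subtracting the largest multiple of `x` below `y` leaves an eigenvector with a zero entry.
  obtain ⟨w, hw⟩ := Finite.exists_min fun i => y i / x i
  refine ⟨y w / x w, ?_⟩
  by_contra hne
  have hpos := mulVec_pos hB (z := y - (y w / x w) • x)
    (fun i => by simpa using (le_div_iff₀ (hx i)).1 (hw i)) (sub_ne_zero.2 hne) w
  rw [mulVec_sub, mulVec_smul, hBx, hBy] at hpos
  simp only [Pi.sub_apply, Pi.smul_apply, smul_eq_mul] at hpos
  have hcancel : y w / x w * (r * x w) = r * y w := by field_simp [(hx w).ne']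
  linarith

theorem exists_pos_commute {A : Matrix n n ℝ} (hA : A.IsIrreducible) :
    ∃ B : Matrix n n ℝ, (∀ i j, 0 < B i j) ∧ ∀ C, Commute C A → Commute C B := by
  classical
  choose m _ hpos using (isIrreducible_iff_exists_pow_pos hA.nonneg).1 hA
  have hnn : ∀ a b i j, 0 ≤ (A ^ m a b) i j := fun a b => pow_apply_nonneg hA.nonneg _
  refine ⟨∑ a, ∑ b, A ^ m a b, fun i j => ?_, fun C hC => Commute.sum_right _ _ _ fun a _ =>
    Commute.sum_right _ _ _ fun b _ => hC.pow_right _⟩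
  simp only [Matrix.sum_apply]
  refine Finset.sum_pos' (fun a _ => Finset.sum_nonneg fun b _ => hnn a b i j)
    ⟨i, Finset.mem_univ i, ?_⟩
  exact Finset.sum_pos' (fun b _ => hnn i b i j) ⟨j, Finset.mem_univ j, hpos i j⟩

theorem exists_pos_common_eigenvector [Nonempty n] {A : Matrix n n ℝ}
    (hA : A.IsIrreducible) : ∃ x : n → ℝ, (∀ i, 0 < x i) ∧ ∑ i, x i = 1 ∧
      ∀ C : Matrix n n ℝ, Commute C A → ∃ c : ℝ, C *ᵥ x = c • x := by
  obtain ⟨B, hB, hcomm⟩ := exists_pos_commute hA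
  obtain ⟨x, r, hx, hx1, hBx⟩ := exists_pos_eigenvector hB
  refine ⟨x, hx, hx1, fun C hC => eq_smul_of_mulVec_eq_smul hB hx hBx ?_⟩
  rw [mulVec_mulVec, ← (hcomm C hC).eq, ← mulVec_mulVec, hBx, mulVec_smul]

theorem mem_spectrum_iff_exists_mulVec {K : Type*} [Field K] [DecidableEq n] {M : Matrix n n K}
    {μ : K} : μ ∈ spectrum K M ↔ ∃ z ≠ 0, M *ᵥ z = μ • z := by
  rw [← Matrix.spectrum_toLin', ← Module.End.hasEigenvalue_iff_mem_spectrum]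
  refine ⟨fun h => ?_, fun ⟨z, hz0, hz⟩ => Module.End.hasEigenvalue_of_hasEigenvector
    ⟨Module.End.mem_eigenspace_iff.2 (by rwa [toLin'_apply]), hz0⟩⟩
  obtain ⟨z, hz⟩ := h.exists_hasEigenvector
  exact ⟨z, hz.2, by simpa only [toLin'_apply] using hz.apply_eq_smul⟩

theorem norm_le_of_mulVec_eq_smul {A : Matrix n n ℝ} (hA : ∀ i j, 0 ≤ A i j) {x : n → ℝ} {r : ℝ}
    (hx : ∀ i, 0 < x i) (hAx : A *ᵥ x = r • x) {z : n → ℂ} {μ : ℂ} (hz0 : z ≠ 0)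
    (hz : A.map ((↑) : ℝ → ℂ) *ᵥ z = μ • z) : ‖μ‖ ≤ r := by
  obtain ⟨j, hj⟩ := Function.ne_iff.1 hz0
  have : Nonempty n := ⟨j⟩
  obtain ⟨w, hw⟩ := Finite.exists_max fun i => ‖z i‖ / x i
  have hle : ∀ i, ‖z i‖ ≤ ‖z w‖ / x w * x i := fun i => (div_le_iff₀ (hx i)).1 (hw i)
  have hzw : 0 < ‖z w‖ :=
    (div_pos_iff_of_pos_right (hx w)).1 ((div_pos (norm_pos_iff.2 hj) (hx j)).trans_le (hw j))
  refine le_of_mul_le_mul_right ?_ hzw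
  calc ‖μ‖ * ‖z w‖ = ‖∑ i, (A w i : ℂ) * z i‖ := by
        rw [← norm_mul]
        exact congrArg norm (congrFun hz w).symm
    _ ≤ ∑ i, ‖(A w i : ℂ) * z i‖ := norm_sum_le _ _
    _ ≤ ∑ i, A w i * (‖z w‖ / x w * x i) := Finset.sum_le_sum fun i _ => by
        rw [norm_mul, Complex.norm_real, Real.norm_of_nonneg (hA w i)]
        exact mul_le_mul_of_nonneg_left (hle i) (hA w i)
    _ = ‖z w‖ / x w * (A *ᵥ x) w := by
        simp only [mulVec, dotProduct, Finset.mul_sum, mul_left_comm]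
    _ = r * ‖z w‖ := by
        rw [hAx, Pi.smul_apply, smul_eq_mul]
        field_simp [(hx w).ne']

theorem nonneg_of_mulVec_eq_smul [Nonempty n] {A : Matrix n n ℝ} (hA : ∀ i j, 0 ≤ A i j)
    {x : n → ℝ} {r : ℝ} (hx : ∀ i, 0 < x i) (hAx : A *ᵥ x = r • x) : 0 ≤ r := by
  obtain ⟨i⟩ := ‹Nonempty n›
  refine nonneg_of_mul_nonneg_left (b := x i) ?_ (hx i)
  have h : (A *ᵥ x) i = r * x i := congrFun hAx i
  exact h ▸ Finset.sum_nonneg fun j _ => mul_nonneg (hA i j) (hx j).le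

theorem spectralRadius_eq_ofReal [Nonempty n] [DecidableEq n] {A : Matrix n n ℝ}
    (hA : ∀ i j, 0 ≤ A i j) {x : n → ℝ} {r : ℝ} (hx : ∀ i, 0 < x i) (hAx : A *ᵥ x = r • x) :
    spectralRadius ℂ (A.map ((↑) : ℝ → ℂ)) = ENNReal.ofReal r := by
  refine le_antisymm (iSup₂_le fun μ hμ => ?_) ?_
  · obtain ⟨z, hz0, hz⟩ := mem_spectrum_iff_exists_mulVec.1 hμ
    rw [← enorm_eq_nnnorm, ← ofReal_norm]
    exact ENNReal.ofReal_le_ofReal (norm_le_of_mulVec_eq_smul hA hx hAx hz0 hz)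
  · have hr : (r : ℂ) ∈ spectrum ℂ (A.map ((↑) : ℝ → ℂ)) := by
      refine mem_spectrum_iff_exists_mulVec.2 ⟨fun i => (x i : ℂ), fun h0 => ?_, funext fun i => ?_⟩
      · obtain ⟨i⟩ := ‹Nonempty n›
        exact (hx i).ne' (Complex.ofReal_eq_zero.1 (congrFun h0 i))
      · simpa [mulVec, dotProduct] using congrArg ((↑) : ℝ → ℂ) (congrFun hAx i)
    refine le_trans (le_of_eq ?_) (le_iSup₂ (f := fun (μ : ℂ) (_ : μ ∈ _) => (‖μ‖₊ : ENNReal)) _ hr)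
    rw [← enorm_eq_nnnorm, ← ofReal_norm, Complex.norm_real,
      Real.norm_of_nonneg (nonneg_of_mulVec_eq_smul hA hx hAx)]

end PerronFrobenius

namespace BratteliDiagram

variable {B : BratteliDiagram.{u}}

instance instFiniteEdge (n : ℕ) (p : B.V n) (q : B.V (n + 1)) : Finite (B.E n p q) :=
  B.finite_E n p q

instance instFiniteVertex (n : ℕ) : Finite (B.V n) := B.finite_V n

noncomputable instance instFintypeExt (γ : B.FinPath) : Fintype γ.Ext := Fintype.ofFinite _

@[elab_as_elim]
theorem FinPath.induction {P : B.FinPath → Prop} (vertex : ∀ v, P (.vertex v))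
    (snoc : ∀ (γ : B.FinPath) (e : γ.Ext), P γ → P (γ.snoc e.2)) (γ : B.FinPath) : P γ := by
  obtain ⟨n, p, γ⟩ := γ
  induction γ with
  | vertex v => exact vertex v
  | @snoc n p q γ e ih => exact snoc ⟨n, p, γ⟩ ⟨q, e⟩ ih

theorem FinPath.snoc_injective (γ : B.FinPath) {e e' : γ.Ext}
    (h : γ.snoc e.2 = γ.snoc e'.2) : e = e' := by
  obtain ⟨q, e⟩ := e
  obtain ⟨q', e'⟩ := e'
  simp only [FinPath.snoc, FinPath.mk.injEq, true_and] at h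
  obtain ⟨rfl, h⟩ := h
  have h' := eq_of_heq h
  injection h' with _ _ _ _ h'
  rw [h']

theorem FinPath.eq_of_snoc_eq {γ γ' : B.FinPath} {e : γ.Ext} {e' : γ'.Ext}
    (h : γ.snoc e.2 = γ'.snoc e'.2) : γ = γ' := by
  obtain ⟨n, p, γ⟩ := γ
  obtain ⟨n', p', γ'⟩ := γ'
  obtain ⟨q, e⟩ := e
  obtain ⟨q', e'⟩ := e'
  simp only [FinPath.snoc, FinPath.mk.injEq, Nat.add_right_cancel_iff] at h
  obtain ⟨rfl, h, h'⟩ := h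
  obtain rfl := eq_of_heq h
  have h'' := eq_of_heq h'
  injection h'' with _ h1 _ h2
  subst h1
  rw [eq_of_heq h2]

theorem FinPath.exists_eq_snoc {γ : B.FinPath} {n : ℕ} (h : γ.len = n + 1) :
    ∃ (η : B.FinPath) (e : η.Ext), η.len = n ∧ γ = η.snoc e.2 := by
  induction γ using FinPath.induction with
  | vertex v => exact absurd h (Nat.succ_ne_zero n).symm
  | snoc η e _ => exact ⟨η, e, Nat.succ_injective h, rfl⟩

theorem FinPath.exists_eq_vertex {γ : B.FinPath} (h : γ.len = 0) : ∃ v, γ = .vertex v := by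
  induction γ using FinPath.induction with
  | vertex v => exact ⟨v, rfl⟩
  | snoc η e _ => exact absurd h (Nat.succ_ne_zero _)

theorem FinPath.exists_len_eq (hE : ∀ γ : B.FinPath, Nonempty γ.Ext) (v : B.V 0) (n : ℕ) :
    ∃ γ : B.FinPath, γ.len = n := by
  induction n with
  | zero => exact ⟨.vertex v, rfl⟩
  | succ n ih =>
    obtain ⟨γ, rfl⟩ := ih
    exact ⟨γ.snoc (hE γ).some.2, rfl⟩

theorem finite_len_eq (n : ℕ) : {γ : B.FinPath | γ.len = n}.Finite := by
  induction n with
  | zero =>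
    refine (Set.finite_range (FinPath.vertex (B := B))).subset fun γ hγ => ?_
    obtain ⟨v, rfl⟩ := FinPath.exists_eq_vertex hγ
    exact ⟨v, rfl⟩
  | succ n ih =>
    refine (ih.biUnion fun η _ => Set.finite_range fun e : η.Ext => η.snoc e.2).subset
      fun γ hγ => ?_
    obtain ⟨η, e, hη, rfl⟩ := FinPath.exists_eq_snoc hγ
    exact Set.mem_biUnion hη ⟨e, rfl⟩

theorem finite_len_lt (n : ℕ) : {γ : B.FinPath | γ.len < n}.Finite :=
  ((Set.finite_Iio n).biUnion fun m _ => finite_len_eq m).subset fun _ hγ =>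
    Set.mem_biUnion hγ rfl

instance instCountableFinPath : Countable B.FinPath :=
  Set.countable_univ_iff.1 <| (Set.countable_iUnion fun n => (finite_len_eq n).countable).mono
    fun γ _ => Set.mem_iUnion.2 ⟨γ.len, rfl⟩

theorem InfPath.trunc_succ (x : B.InfPath) (n : ℕ) :
    x.trunc (n + 1) = (x.trunc n).snoc (x.edge n) := rfl

theorem InfPath.trunc_eq_of_le {x y : B.InfPath} {m n : ℕ} (hmn : m ≤ n)
    (h : x.trunc n = y.trunc n) : x.trunc m = y.trunc m := by
  induction n, hmn using Nat.le_induction with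
  | base => exact h
  | succ n _ ih =>
    exact ih (FinPath.eq_of_snoc_eq (e := ⟨_, x.edge n⟩) (e' := ⟨_, y.edge n⟩) h)

theorem InfPath.isSubpath_trunc (x : B.InfPath) {m n : ℕ} (h : m ≤ n) :
    (x.trunc m).IsSubpath (x.trunc n) := by
  induction n, h using Nat.le_induction with
  | base => exact .refl
  | succ n _ ih => exact .snoc ih _

theorem InfPath.ext_of_trunc {x y : B.InfPath} (h : ∀ n, x.trunc n = y.trunc n) : x = y := by
  obtain ⟨v, e⟩ := x
  obtain ⟨v', e'⟩ := y
  obtain rfl : v = v' := funext fun n => by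
    have hn := h n
    simp only [trunc, FinPath.mk.injEq, heq_eq_eq, true_and] at hn
    exact hn.1
  congr
  funext n
  have hn := h (n + 1)
  simp only [trunc, initial, FinPath.mk.injEq, heq_eq_eq, true_and] at hn
  injection hn

theorem mem_cylinder {x : B.InfPath} {γ : B.FinPath} : x ∈ cylinder γ ↔ x.trunc γ.len = γ :=
  Iff.rfl

theorem InfPath.mem_cylinder_trunc (x : B.InfPath) (n : ℕ) : x ∈ cylinder (x.trunc n) :=
  rfl

theorem cylinder_snoc_subset (γ : B.FinPath) (e : γ.Ext) :
    cylinder (γ.snoc e.2) ⊆ cylinder γ := fun x hx =>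
  FinPath.eq_of_snoc_eq (e := ⟨_, x.edge γ.len⟩) (e' := e) hx

theorem exists_mem_cylinder_snoc {γ : B.FinPath} {x : B.InfPath} (hx : x ∈ cylinder γ) :
    ∃ e : γ.Ext, x ∈ cylinder (γ.snoc e.2) := by
  obtain ⟨n, p, γ⟩ := γ
  have h1 : x.trunc n = ⟨n, p, γ⟩ := hx
  rw [← h1]
  exact ⟨⟨_, x.edge n⟩, rfl⟩

theorem eq_of_mem_cylinder {γ η : B.FinPath} {x : B.InfPath} (hγ : x ∈ cylinder γ)
    (hη : x ∈ cylinder η) (h : γ.len = η.len) : γ = η := by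
  rw [← mem_cylinder.1 hγ, ← mem_cylinder.1 hη, h]

theorem ext_eq_of_mem_cylinder {γ : B.FinPath} {e e' : γ.Ext} {x : B.InfPath}
    (h : x ∈ cylinder (γ.snoc e.2)) (h' : x ∈ cylinder (γ.snoc e'.2)) : e = e' :=
  γ.snoc_injective (eq_of_mem_cylinder h h' rfl)

theorem cylinder_subset_of_mem {γ η : B.FinPath} {x : B.InfPath} (hγ : x ∈ cylinder γ)
    (hη : x ∈ cylinder η) (h : γ.len ≤ η.len) : cylinder η ⊆ cylinder γ := fun y hy => by
  have h1 : y.trunc η.len = x.trunc η.len := hy.trans hη.symm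
  exact (InfPath.trunc_eq_of_le h h1).trans hγ

/-! ## The ultrametric of a weight -/

theorem bddAbove_trunc_eq {x y : B.InfPath} (hne : x ≠ y) :
    BddAbove {n | x.trunc n = y.trunc n} := by
  obtain ⟨N, hN⟩ := not_forall.1 (mt InfPath.ext_of_trunc hne)
  exact ⟨N, fun n hn => not_lt.1 fun h => hN (InfPath.trunc_eq_of_le h.le hn)⟩

variable {w : B.FinPath → ℝ}

theorem trunc_eq_trunc_of_mem_cylinder {γ : B.FinPath} {x y : B.InfPath}
    (hx : x ∈ cylinder γ) (hy : y ∈ cylinder γ) : x.trunc γ.len = y.trunc γ.len :=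
  (mem_cylinder.1 hx).trans (mem_cylinder.1 hy).symm

theorem dist_le_of_mem_cylinder (hw : IsWeight w) {γ : B.FinPath} {x y : B.InfPath}
    (hx : x ∈ cylinder γ) (hy : y ∈ cylinder γ) : dist w x y ≤ w γ := by
  have htr := trunc_eq_trunc_of_mem_cylinder hx hy
  have h0 : ¬ x.trunc 0 ≠ y.trunc 0 := not_not.2 (InfPath.trunc_eq_of_le (Nat.zero_le _) htr)
  rw [dist, if_neg h0]
  split_ifs with hxy
  · exact (hw.pos γ).le
  · have hle : γ.len ≤ sSup {n | x.trunc n = y.trunc n} := le_csSup (bddAbove_trunc_eq hxy) htr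
    have hsub := x.isSubpath_trunc hle
    rw [mem_cylinder.1 hx] at hsub
    by_cases heq : γ = x.trunc (sSup {n | x.trunc n = y.trunc n})
    · exact (congrArg w heq).ge
    · exact (hw.strict _ _ hsub heq).le

theorem weight_snoc_lt (hw : IsWeight w) (γ : B.FinPath) (e : γ.Ext) : w (γ.snoc e.2) < w γ :=
  hw.strict _ _ (.snoc .refl e.2) fun h =>
    absurd (congrArg FinPath.len h) (Nat.succ_ne_self γ.len).symm

theorem dist_eq_of_mem_cylinder_snoc {γ : B.FinPath} {e e' : γ.Ext} (hne : e ≠ e')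
    {x y : B.InfPath} (hx : x ∈ cylinder (γ.snoc e.2)) (hy : y ∈ cylinder (γ.snoc e'.2)) :
    dist w x y = w γ := by
  have hx' := cylinder_snoc_subset γ e hx
  have hy' := cylinder_snoc_subset γ e' hy
  have htr := trunc_eq_trunc_of_mem_cylinder hx' hy'
  have h0 : ¬ x.trunc 0 ≠ y.trunc 0 := not_not.2 (InfPath.trunc_eq_of_le (Nat.zero_le _) htr)
  have hxy : x ≠ y := by
    rintro rfl
    exact hne (ext_eq_of_mem_cylinder hx hy)
  have hset : {n | x.trunc n = y.trunc n} = Set.Iic γ.len := by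
    ext n
    refine ⟨fun hn => Set.mem_Iic.2 (not_lt.1 fun hlt => hne ?_),
      fun hn => InfPath.trunc_eq_of_le hn htr⟩
    have h1 : x.trunc (γ.len + 1) = y.trunc (γ.len + 1) := InfPath.trunc_eq_of_le hlt hn
    have h2 : x.trunc (γ.len + 1) = γ.snoc e.2 := hx
    have h3 : y.trunc (γ.len + 1) = γ.snoc e'.2 := hy
    exact γ.snoc_injective (h2.symm.trans (h1.trans h3))
  rw [dist, if_neg h0, if_neg hxy, hset, csSup_Iic, mem_cylinder.1 hx']

theorem exists_ext_ne (hw : IsWeight w) {γ : B.FinPath} (h : w γ = diam w γ) :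
    ∃ e e' : γ.Ext, e ≠ e' := by
  by_contra! hcon
  refine (hw.pos γ).not_ge ?_
  rcases isEmpty_or_nonempty γ.Ext with hE | ⟨⟨e⟩⟩
  · have hemp : {d | ∃ x ∈ cylinder γ, ∃ y ∈ cylinder γ, d = dist w x y} = ∅ := by
      ext d
      simp only [Set.mem_ofPred_eq, Set.mem_empty_iff_false, iff_false]
      rintro ⟨x, hx, -⟩
      exact hE.false (exists_mem_cylinder_snoc hx).choose
    rw [h, diam, hemp, Real.sSup_empty]
  · refine absurd h (ne_of_gt (lt_of_le_of_lt ?_ (weight_snoc_lt hw γ e)))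
    refine Real.sSup_le ?_ (hw.pos _).le
    rintro _ ⟨x, hx, y, hy, rfl⟩
    obtain ⟨e₁, hx⟩ := exists_mem_cylinder_snoc hx
    obtain ⟨e₂, hy⟩ := exists_mem_cylinder_snoc hy
    rw [hcon e₁ e] at hx
    rw [hcon e₂ e] at hy
    exact dist_le_of_mem_cylinder hw hx hy

end BratteliDiagram

/-! ## Measures on the infinite path space of a Bratteli diagram -/

namespace BratteliDiagram

variable {B : BratteliDiagram.{u}}

instance instMeasurableSpaceInfPath : MeasurableSpace B.InfPath :=
  MeasurableSpace.generateFrom (Set.range cylinder)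

instance instMeasurableSpaceExt (γ : B.FinPath) : MeasurableSpace γ.Ext := ⊤

variable (B) in
/-- A choice of an extension of every finite path. Choosing the extensions independently at random
produces a random infinite path. -/
abbrev ExtChoice : Type u := ∀ γ : B.FinPath, γ.Ext

namespace ExtChoice

/-- The initial segments of the infinite path with range `v` that follows a choice of
extensions. -/
def follow (ω : B.ExtChoice) (v : B.V 0) : (n : ℕ) → Σ p : B.V n, B.Path n p
  | 0 => ⟨v, .vertex v⟩
  | n + 1 => ⟨(ω ⟨n, (ω.follow v n).1, (ω.follow v n).2⟩).1,
      (ω.follow v n).2.snoc (ω ⟨n, (ω.follow v n).1, (ω.follow v n).2⟩).2⟩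

/-- The infinite path with range `v` that follows a choice of extensions. -/
def toInfPath (ω : B.ExtChoice) (v : B.V 0) : B.InfPath where
  vert n := (ω.follow v n).1
  edge n := (ω ⟨n, (ω.follow v n).1, (ω.follow v n).2⟩).2

theorem trunc_toInfPath (ω : B.ExtChoice) (v : B.V 0) (n : ℕ) :
    (ω.toInfPath v).trunc n = ⟨n, (ω.follow v n).1, (ω.follow v n).2⟩ := by
  have h : (ω.toInfPath v).initial n = (ω.follow v n).2 := by
    induction n with
    | zero => rfl
    | succ n ih => rw [InfPath.initial, ih]; rfl
  rw [InfPath.trunc, h]; rfl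

theorem trunc_succ_toInfPath (ω : B.ExtChoice) (v : B.V 0) (n : ℕ) :
    (ω.toInfPath v).trunc (n + 1)
      = ((ω.toInfPath v).trunc n).snoc (ω ((ω.toInfPath v).trunc n)).2 := by
  rw [trunc_toInfPath, trunc_toInfPath]; rfl

theorem toInfPath_mem_cylinder_vertex {ω : B.ExtChoice} {v v₀ : B.V 0} :
    ω.toInfPath v ∈ cylinder (.vertex v₀) ↔ v = v₀ := by
  refine ⟨fun h => ?_, by rintro rfl; rfl⟩
  have h' : (FinPath.vertex v : B.FinPath) = .vertex v₀ := h
  injection h'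

theorem toInfPath_mem_cylinder_snoc {ω : B.ExtChoice} {v : B.V 0} {γ : B.FinPath} {e : γ.Ext} :
    ω.toInfPath v ∈ cylinder (γ.snoc e.2) ↔ ω.toInfPath v ∈ cylinder γ ∧ ω γ = e := by
  have key (hγ : ω.toInfPath v ∈ cylinder γ) :
      (ω.toInfPath v).trunc (γ.len + 1) = γ.snoc (ω γ).2 := by
    rw [trunc_succ_toInfPath, mem_cylinder.1 hγ]
  refine ⟨fun h => ?_, ?_⟩
  · have hγ := cylinder_snoc_subset γ e h
    exact ⟨hγ, γ.snoc_injective ((key hγ).symm.trans h)⟩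
  · rintro ⟨hγ, rfl⟩
    exact key hγ

end ExtChoice

section ExistsMeasure

variable {m : B.FinPath → NNReal} (hm : ∀ γ, 0 < m γ)
  (hadd : ∀ γ : B.FinPath, ∑ e : γ.Ext, m (γ.snoc e.2) = m γ)

/-- The transition probabilities `m (γ e) / m γ` of an additive mass distribution `m`. -/
noncomputable def extPMF (γ : B.FinPath) : PMF γ.Ext :=
  PMF.ofFintype (fun e => ↑(m (γ.snoc e.2) / m γ)) <| by
    rw [← ENNReal.ofNNReal_finsetSum, ← Finset.sum_div, hadd, div_self (hm γ).ne',
      ENNReal.coe_one]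

theorem mul_extPMF_singleton (γ : B.FinPath) (e : γ.Ext) :
    m γ * (extPMF hm hadd γ).toMeasure {e} = m (γ.snoc e.2) := by
  rw [PMF.toMeasure_apply_singleton _ _ MeasurableSpace.measurableSet_top, extPMF,
    PMF.ofFintype_apply, ← ENNReal.coe_mul, mul_div_cancel₀ _ (hm γ).ne']

theorem exists_box (γ : B.FinPath) :
    ∃ (v₀ : B.V 0) (s : Finset B.FinPath) (t : ∀ η : B.FinPath, Set η.Ext),
      (∀ η ∈ s, η.len < γ.len) ∧
      (∀ v (ω : B.ExtChoice), ω.toInfPath v ∈ cylinder γ ↔ v = v₀ ∧ ω ∈ Set.pi s t) ∧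
      m (.vertex v₀) * ∏ η ∈ s, (extPMF hm hadd η).toMeasure (t η) = m γ := by
  classical
  induction γ using FinPath.induction with
  | vertex v₀ =>
    exact ⟨v₀, ∅, fun _ => ∅, by simp, by simp [ExtChoice.toInfPath_mem_cylinder_vertex], by simp⟩
  | snoc γ e ih =>
    obtain ⟨v₀, s, t, hlen, hmem, hprod⟩ := ih
    have hγ : γ ∉ s := fun h => (hlen _ h).false
    have hupdate (η) (hη : η ∈ s) : Function.update t γ {e} η = t η :=
      Function.update_of_ne (ne_of_mem_of_not_mem hη hγ) _ _
    refine ⟨v₀, insert γ s, Function.update t γ {e}, ?_, fun v ω => ?_, ?_⟩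
    · intro η hη
      obtain rfl | hη := Finset.mem_insert.1 hη
      exacts [Nat.lt_succ_self _, (hlen η hη).trans (Nat.lt_succ_self _)]
    · have hpi : Set.pi (s : Set B.FinPath) (Function.update t γ {e}) = Set.pi s t :=
        Set.pi_congr rfl hupdate
      rw [ExtChoice.toInfPath_mem_cylinder_snoc, hmem, Finset.coe_insert, Set.insert_pi, hpi,
        Function.update_self, Set.mem_inter_iff, Set.mem_preimage, Set.mem_singleton_iff,
        Function.eval, and_assoc, and_comm (a := ω γ = e)]
    · rw [Finset.prod_insert hγ, Function.update_self,
        Finset.prod_congr rfl fun η hη => by rw [hupdate η hη], mul_left_comm, hprod, mul_comm,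
        mul_extPMF_singleton]

include hm hadd in
theorem exists_measure_cylinder_eq :
    ∃ μ : Measure B.InfPath, ∀ γ, μ (cylinder γ) = m γ := by
  classical
  have := Fintype.ofFinite (B.V 0)
  let P : Measure B.ExtChoice := Measure.infinitePi fun γ => (extPMF hm hadd γ).toMeasure
  have hmeas (v : B.V 0) : Measurable fun ω : B.ExtChoice => ω.toInfPath v := by
    refine measurable_generateFrom ?_
    rintro _ ⟨γ, rfl⟩
    obtain ⟨v₀, s, t, -, hmem, -⟩ := exists_box hm hadd γ
    rw [Set.preimage]
    simp only [hmem, measurableSet_setOfPred]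
    exact (measurable_const (a := v = v₀)).and
      (measurableSet_setOfPred.1 <| MeasurableSet.pi s.countable_toSet fun p _ => trivial)
  refine ⟨∑ v : B.V 0, (m (.vertex v) : ENNReal) • P.map fun ω => ω.toInfPath v, fun γ => ?_⟩
  obtain ⟨v₀, s, t, -, hmem, hprod⟩ := exists_box hm hadd γ
  have hγ (v : B.V 0) : (P.map fun ω => ω.toInfPath v) (cylinder γ)
      = if v = v₀ then ∏ η ∈ s, (extPMF hm hadd η).toMeasure (t η) else 0 := by
    rw [Measure.map_apply (hmeas v) (MeasurableSpace.measurableSet_generateFrom ⟨γ, rfl⟩),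
      Set.preimage]
    split_ifs with hv
    · simp only [hmem, hv, true_and]
      exact Measure.infinitePi_pi _ fun p _ => trivial
    · simp [hmem, hv]
  simp only [Measure.finsetSum_apply, Measure.smul_apply, hγ, smul_eq_mul, mul_ite, mul_zero,
    Finset.sum_ite_eq', Finset.mem_univ, if_true, hprod]

end ExistsMeasure

end BratteliDiagram

namespace KGraph

variable {k : ℕ} {Λ : KGraph.{u} k}

/-! ## Factorizations -/

theorem comp_inj {f g f' g' : Λ.Mor} {h : Λ.s f = Λ.r g} {h' : Λ.s f' = Λ.r g'}
    (heq : Λ.comp f g h = Λ.comp f' g' h') (hd : Λ.deg f = Λ.deg f') : f = f' ∧ g = g' := by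
  have h1 := Λ.deg_comp f g h
  have h2 := Λ.deg_comp f' g' h'
  have hg : Λ.deg g = Λ.deg g' := by
    rw [heq, h2, hd] at h1
    exact (add_left_cancel h1).symm
  have hu := (Λ.factorization _ _ _ h1).unique (y₁ := (f, g)) (y₂ := (f', g'))
    ⟨rfl, rfl, h, rfl⟩ ⟨hd.symm, hg.symm, h', heq.symm⟩
  exact ⟨congrArg Prod.fst hu, congrArg Prod.snd hu⟩

theorem exists_comp {f : Λ.Mor} {m n : Fin k → ℕ} (h : Λ.deg f = m + n) :
    ∃ (a b : Λ.Mor) (hab : Λ.s a = Λ.r b), Λ.deg a = m ∧ Λ.deg b = n ∧ Λ.comp a b hab = f := by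
  obtain ⟨⟨a, b⟩, ⟨h1, h2, h3, h4⟩, -⟩ := Λ.factorization f m n h
  exact ⟨a, b, h3, h1, h2, h4⟩

theorem eq_one_of_deg_eq_zero {f : Λ.Mor} (h : Λ.deg f = 0) : f = Λ.one (Λ.r f) :=
  (comp_inj ((Λ.one_comp f).trans (Λ.comp_one f).symm) ((Λ.deg_one _).trans h.symm)).1.symm

theorem comp_eq_of_deg_eq_zero {a c : Λ.Mor} (ha : Λ.deg a = 0) (h : Λ.s a = Λ.r c) :
    Λ.comp a c h = c := by
  obtain ⟨v, rfl⟩ : ∃ v, a = Λ.one v := ⟨_, eq_one_of_deg_eq_zero ha⟩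
  obtain rfl : v = Λ.r c := (Λ.s_one v).symm.trans h
  exact Λ.one_comp c

/-- `f` is an initial segment of `g`. -/
def IsInitial (f g : Λ.Mor) : Prop := ∃ (c : Λ.Mor) (h : Λ.s f = Λ.r c), Λ.comp f c h = g

theorem IsInitial.refl (f : Λ.Mor) : IsInitial f f := ⟨_, _, Λ.comp_one f⟩

theorem isInitial_comp (f g : Λ.Mor) (h : Λ.s f = Λ.r g) : IsInitial f (Λ.comp f g h) :=
  ⟨g, h, rfl⟩

theorem IsInitial.trans {f g h : Λ.Mor} (hfg : IsInitial f g) (hgh : IsInitial g h) :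
    IsInitial f h := by
  obtain ⟨c, hc, rfl⟩ := hfg
  obtain ⟨d, hd, rfl⟩ := hgh
  exact ⟨Λ.comp c d ((Λ.s_comp _ _ _).symm.trans hd), hc.trans (Λ.r_comp _ _ _).symm,
    (Λ.assoc _ _ _ _ _).symm⟩

theorem IsInitial.eq_of_deg_eq {f g h : Λ.Mor} (hf : IsInitial f h) (hg : IsInitial g h)
    (hd : Λ.deg f = Λ.deg g) : f = g := by
  obtain ⟨c, hc, rfl⟩ := hf
  obtain ⟨d, hd', h2⟩ := hg
  exact (comp_inj h2.symm hd).1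

theorem exists_isInitial {f : Λ.Mor} {m : Fin k → ℕ} (h : m ≤ Λ.deg f) :
    ∃ g, Λ.deg g = m ∧ IsInitial g f := by
  obtain ⟨a, b, hab, ha, -, rfl⟩ := exists_comp (add_tsub_cancel_of_le h).symm
  exact ⟨a, ha, isInitial_comp _ _ _⟩

theorem IsInitial.of_deg_le {f g h : Λ.Mor} (hf : IsInitial f h) (hg : IsInitial g h)
    (hd : Λ.deg f ≤ Λ.deg g) : IsInitial f g := by
  obtain ⟨f', hf', hf'g⟩ := exists_isInitial hd
  obtain rfl := (hf'g.trans hg).eq_of_deg_eq hf hf'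
  exact hf'g

theorem InfPath.isInitial_mor (x : Λ.InfPath) {m n : Fin k → ℕ} (h : m ≤ n) :
    IsInitial (x.mor 0 m zero_le) (x.mor 0 n zero_le) :=
  ⟨_, _, x.mor_comp 0 m n zero_le h⟩

theorem InfPath.mem_cylinder_iff (x : Λ.InfPath) (f : Λ.Mor) :
    x ∈ cylinder f ↔ x.mor 0 (Λ.deg f) zero_le = f := Iff.rfl

theorem InfPath.mem_cylinder_iff_isInitial (x : Λ.InfPath) {f : Λ.Mor} {n : Fin k → ℕ}
    (h : Λ.deg f ≤ n) : x ∈ cylinder f ↔ IsInitial f (x.mor 0 n zero_le) := by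
  refine ⟨fun hx => ?_, fun hf => ?_⟩
  · have := x.isInitial_mor h
    rwa [(x.mem_cylinder_iff f).1 hx] at this
  · exact (x.isInitial_mor h).eq_of_deg_eq hf (by rw [x.deg_mor, tsub_zero])

/-! ## The vertices, edges and finite paths of the diagram -/

instance instFiniteColorEdge [hΛ : Λ.IsFinite] (i : Fin k) (v w : Λ.Obj) :
    Finite (Λ.ColorEdge i v w) :=
  ((hΛ.finite_deg (Pi.single i 1)).subset (fun _ hf => hf.1)).to_subtype

theorem rainbow_zero (k : ℕ) : rainbow k 0 = 0 := by
  funext i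
  simp [rainbow]

theorem rainbow_mul (k n : ℕ) [NeZero k] : rainbow k (n * k) = fun _ => n := by
  funext i
  simp [rainbow, NeZero.ne k]

theorem exists_le_rainbow {k : ℕ} [NeZero k] (n : Fin k → ℕ) : ∃ N, n ≤ rainbow k N := by
  refine ⟨(∑ i, n i) * k, fun i => ?_⟩
  rw [rainbow_mul]
  exact Finset.single_le_sum (fun _ _ => Nat.zero_le _) (Finset.mem_univ i)

variable [NeZero k] [Λ.IsFinite]

/-- The product of the edges of a finite path of the diagram, with its degree and source. -/
def pathMorAux : {n : ℕ} → {p : Λ.bratteli.V n} → Λ.bratteli.Path n p →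
    {f : Λ.Mor // Λ.deg f = rainbow k n ∧ Λ.s f = p}
  | _, _, .vertex v => ⟨Λ.one v, (Λ.deg_one v).trans (rainbow_zero k).symm, Λ.s_one v⟩
  | _, _, .snoc γ e => ⟨Λ.comp (pathMorAux γ).1 e.1 ((pathMorAux γ).2.2.trans e.2.2.1.symm),
      by rw [Λ.deg_comp, (pathMorAux γ).2.1, e.2.1, rainbow_succ],
      by rw [Λ.s_comp, e.2.2.2]⟩

/-- The product of the edges of a finite path of the diagram. -/
def pathMor (γ : Λ.bratteli.FinPath) : Λ.Mor := (pathMorAux γ.path).1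

theorem deg_pathMor (γ : Λ.bratteli.FinPath) : Λ.deg (pathMor γ) = rainbow k γ.len :=
  (pathMorAux γ.path).2.1

theorem s_pathMor (γ : Λ.bratteli.FinPath) : Λ.s (pathMor γ) = γ.src :=
  (pathMorAux γ.path).2.2

theorem pathMor_vertex (v : Λ.bratteli.V 0) : pathMor (.vertex v) = Λ.one v := rfl

theorem pathMor_snoc (γ : Λ.bratteli.FinPath) (e : γ.Ext) :
    pathMor (γ.snoc e.2) = Λ.comp (pathMor γ) e.2.1 ((s_pathMor γ).trans e.2.2.2.1.symm) := rfl

theorem pathMor_injective {γ η : Λ.bratteli.FinPath} (h : pathMor γ = pathMor η)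
    (hl : γ.len = η.len) : γ = η := by
  induction γ using BratteliDiagram.FinPath.induction generalizing η with
  | vertex v =>
    obtain ⟨w, rfl⟩ := BratteliDiagram.FinPath.exists_eq_vertex hl.symm
    rw [pathMor_vertex, pathMor_vertex] at h
    have hvw : v = w := (Λ.r_one v).symm.trans ((congrArg Λ.r h).trans (Λ.r_one w))
    rw [hvw]
  | snoc γ e ih =>
    obtain ⟨η, e', hη, rfl⟩ := BratteliDiagram.FinPath.exists_eq_snoc hl.symm
    rw [pathMor_snoc, pathMor_snoc] at h
    obtain ⟨h1, h2⟩ := comp_inj h (by rw [deg_pathMor, deg_pathMor, hη])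
    obtain rfl := ih h1 hη.symm
    obtain ⟨q, e⟩ := e
    obtain ⟨q', e'⟩ := e'
    obtain rfl : q = q' := by rw [← e.2.2.2, ← e'.2.2.2, h2]
    obtain rfl : e = e' := Subtype.ext h2
    rfl

theorem exists_pathMor_eq {n : ℕ} {f : Λ.Mor} (hf : Λ.deg f = rainbow k n) :
    ∃ γ : Λ.bratteli.FinPath, γ.len = n ∧ pathMor γ = f := by
  induction n generalizing f with
  | zero =>
    rw [rainbow_zero] at hf
    exact ⟨.vertex (Λ.r f), rfl, (eq_one_of_deg_eq_zero hf).symm⟩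
  | succ n ih =>
    obtain ⟨a, b, hab, ha, hb, rfl⟩ := exists_comp (hf.trans (rainbow_succ k n))
    obtain ⟨γ, rfl, rfl⟩ := ih ha
    exact ⟨γ.snoc (q := Λ.s b) ⟨b, hb, by rw [← hab, s_pathMor], rfl⟩, rfl, rfl⟩

theorem InfPath.pathMor_trunc (x : Λ.InfPath) (n : ℕ) :
    pathMor (x.toBratteli.trunc n) = x.mor 0 (rainbow k n) zero_le := by
  induction n with
  | zero =>
    have h : ∀ (m : Fin k → ℕ) (_ : m = 0), Λ.one (x.obj m) = x.mor 0 m zero_le := by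
      rintro m rfl
      exact (x.mor_self 0).symm
    exact h _ (rainbow_zero k)
  | succ n ih =>
    have h := pathMor_snoc (x.toBratteli.trunc n) ⟨_, x.toBratteli.edge n⟩
    rw [BratteliDiagram.InfPath.trunc_succ]
    refine h.trans ?_
    rw [← x.mor_comp 0 (rainbow k n) (rainbow k (n + 1)) zero_le (rainbow_le_succ k n)]
    congr 1

theorem mem_pathCylinder_iff {x : Λ.InfPath} {γ : Λ.bratteli.FinPath} :
    x ∈ pathCylinder γ ↔ x.mor 0 (rainbow k γ.len) zero_le = pathMor γ := by
  rw [← x.pathMor_trunc]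
  exact ⟨fun h => congrArg pathMor h, fun h => pathMor_injective h rfl⟩

theorem pathCylinder_eq_cylinder (γ : Λ.bratteli.FinPath) :
    pathCylinder γ = cylinder (pathMor γ) := by
  ext x
  rw [mem_pathCylinder_iff, InfPath.mem_cylinder_iff]
  simp only [deg_pathMor]

end KGraph

/-! ## The Perron–Frobenius eigenvector of a `k`-graph -/

namespace KGraph

variable {k : ℕ} {Λ : KGraph.{u} k}

theorem adj_nonneg (i : Fin k) (v w : Λ.Obj) : 0 ≤ Λ.adj i v w := Nat.cast_nonneg _

variable [Λ.IsFinite]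


theorem adj_mul_adj_apply (i j : Fin k) (v w : Λ.Obj) :
    (Λ.adj i * Λ.adj j) v w = (Nat.card {f : Λ.Mor //
      Λ.deg f = Pi.single i 1 + Pi.single j 1 ∧ Λ.r f = v ∧ Λ.s f = w} : ℝ) := by
  have h : Nat.card (Σ u, Λ.ColorEdge i v u × Λ.ColorEdge j u w) = Nat.card {f : Λ.Mor //
      Λ.deg f = Pi.single i 1 + Pi.single j 1 ∧ Λ.r f = v ∧ Λ.s f = w} := by
    refine Nat.card_eq_of_bijective
      (fun p => ⟨Λ.comp p.2.1.1 p.2.2.1 (p.2.1.2.2.2.trans p.2.2.2.2.1.symm),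
        by rw [Λ.deg_comp, p.2.1.2.1, p.2.2.2.1], by rw [Λ.r_comp, p.2.1.2.2.1],
        by rw [Λ.s_comp, p.2.2.2.2.2]⟩) ⟨?_, ?_⟩
    · rintro ⟨u, ⟨e, he⟩, ⟨f, hf⟩⟩ ⟨u', ⟨e', he'⟩, ⟨f', hf'⟩⟩ h
      obtain ⟨rfl, rfl⟩ := comp_inj (congrArg Subtype.val h) (he.1.trans he'.1.symm)
      obtain rfl : u = u' := he.2.2.symm.trans he'.2.2
      rfl
    · rintro ⟨f, hd, hr, hs⟩
      obtain ⟨a, b, hab, ha, hb, rfl⟩ := exists_comp hd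
      exact ⟨⟨Λ.s a, ⟨a, ha, (Λ.r_comp _ _ _).symm.trans hr, rfl⟩,
        ⟨b, hb, hab.symm, (Λ.s_comp _ _ _).symm.trans hs⟩⟩, rfl⟩
  rw [← h, Nat.card_sigma]
  simp [Matrix.mul_apply, adj, Nat.card_prod]

theorem adj_commute (i j : Fin k) : Commute (Λ.adj i) (Λ.adj j) := by
  ext v w
  rw [adj_mul_adj_apply, adj_mul_adj_apply, add_comm]

theorem adj_commute_adjProd (i : Fin k) : Commute (Λ.adj i) Λ.adjProd :=
  Commute.list_prod_right _ _ fun B hB => by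
    obtain ⟨j, rfl⟩ := (List.mem_ofFn' _ _).1 hB
    exact adj_commute i j

theorem exists_isPerronFrobenius [Nonempty Λ.Obj] (hirr : Λ.adjProd.IsIrreducible) :
    ∃ x, Λ.IsPerronFrobenius x := by
  obtain ⟨x, hpos, hsum, hx⟩ := PerronFrobenius.exists_pos_common_eigenvector hirr
  refine ⟨x, hpos, hsum, fun i => ?_⟩
  obtain ⟨c, hc⟩ := hx _ (adj_commute_adjProd i)
  have hc0 : 0 ≤ c := PerronFrobenius.nonneg_of_mulVec_eq_smul (adj_nonneg i) hpos hc
  rw [hc, rho, PerronFrobenius.spectralRadius_eq_ofReal (adj_nonneg i) hpos hc,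
    ENNReal.toReal_ofReal hc0]

theorem isPerronFrobenius_perron (hx : ∃ x, Λ.IsPerronFrobenius x) :
    Λ.IsPerronFrobenius Λ.perron := by
  rw [perron, dif_pos hx]
  exact hx.choose_spec

/-- The edges of color `i` with range `v`. -/
abbrev EdgesFrom (Λ : KGraph.{u} k) (i : Fin k) (v : Λ.Obj) : Type u :=
  Σ w : Λ.Obj, Λ.ColorEdge i v w

theorem IsPerronFrobenius.sum_edgesFrom {x : Λ.Obj → ℝ} (hx : Λ.IsPerronFrobenius x)
    (i : Fin k) (v : Λ.Obj) [hfin : Fintype (Λ.EdgesFrom i v)] :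
    ∑ e : Λ.EdgesFrom i v, x e.1 = Λ.rho i * x v := by
  have (w : Λ.Obj) : Fintype (Λ.ColorEdge i v w) := Fintype.ofFinite _
  obtain rfl : hfin = Sigma.instFintype := Subsingleton.elim _ _
  have h : ∑ w, Λ.adj i v w * x w = Λ.rho i * x v := congrFun (hx.eigen i) v
  rw [← h, Fintype.sum_sigma]
  simp [adj, Nat.card_eq_fintype_card]

theorem IsPerronFrobenius.rho_pos [NeZero k] {x : Λ.Obj → ℝ} (hx : Λ.IsPerronFrobenius x)
    (hE : ∀ γ : Λ.bratteli.FinPath, Nonempty γ.Ext) (i : Fin k) : 0 < Λ.rho i := by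
  have hne : Nonempty Λ.Obj := by
    by_contra hempty
    have := not_nonempty_iff.1 hempty
    simpa using hx.sum_eq
  obtain ⟨v⟩ := hne
  obtain ⟨w, hw⟩ : ∃ w : Λ.Obj, Nonempty (Λ.EdgesFrom i w) := by
    obtain ⟨γ, hγ⟩ := BratteliDiagram.FinPath.exists_len_eq hE v i
    have hi : Fin.ofNat k γ.len = i := by rw [hγ, Fin.ofNat_val_eq_self]
    exact ⟨γ.src, hi ▸ hE γ⟩
  have := Fintype.ofFinite (Λ.EdgesFrom i w)
  have hsum : 0 < Λ.rho i * x w := by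
    rw [← hx.sum_edgesFrom]
    exact Finset.sum_pos (fun e _ => hx.pos e.1) Finset.univ_nonempty
  exact pos_of_mul_pos_left hsum (hx.pos w).le

theorem rhoPow_pos (hρ : ∀ i, 0 < Λ.rho i) (n : Fin k → ℕ) : 0 < Λ.rhoPow n :=
  Finset.prod_pos fun i _ => pow_pos (hρ i) _

theorem rhoPow_zero : Λ.rhoPow 0 = 1 := by simp [rhoPow]

theorem rhoPow_add_single (n : Fin k → ℕ) (i : Fin k) :
    Λ.rhoPow (n + Pi.single i 1) = Λ.rhoPow n * Λ.rho i := by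
  have hi : ∏ j, Λ.rho j ^ (Pi.single i 1 : Fin k → ℕ) j = Λ.rho i := by
    rw [Finset.prod_eq_single i] <;> simp +contextual
  simp only [rhoPow, Pi.add_apply, pow_add, Finset.prod_mul_distrib, hi]

theorem IsPerronFrobenius.sum_inv_rhoPow_mul {x : Λ.Obj → ℝ} (hx : Λ.IsPerronFrobenius x)
    (hρ : ∀ i, 0 < Λ.rho i) (n : Fin k → ℕ) (i : Fin k) (v : Λ.Obj)
    [Fintype (Λ.EdgesFrom i v)] :
    ∑ e : Λ.EdgesFrom i v, (Λ.rhoPow (n + Pi.single i 1))⁻¹ * x e.1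
      = (Λ.rhoPow n)⁻¹ * x v := by
  rw [← Finset.mul_sum, hx.sum_edgesFrom, rhoPow_add_single]
  field_simp [(hρ i).ne']

end KGraph

/-! ## Cylinder sets of a `k`-graph -/

namespace KGraph

variable {k : ℕ} {Λ : KGraph.{u} k}

theorem cylinder_eq_iUnion_edgesFrom (f : Λ.Mor) (i : Fin k) :
    cylinder f = ⋃ e : Λ.EdgesFrom i (Λ.s f), cylinder (Λ.comp f e.2.1 e.2.2.2.1.symm) := by
  ext x
  rw [Set.mem_iUnion]
  constructor
  · intro hx
    have hle : Λ.deg f ≤ Λ.deg f + Pi.single i 1 := le_self_add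
    have hx' : x.mor 0 (Λ.deg f) zero_le = f := hx
    refine ⟨⟨_, x.mor _ _ hle, by rw [x.deg_mor, add_tsub_cancel_left],
      by rw [x.r_mor, ← x.s_mor 0 _ zero_le, hx'], rfl⟩, ?_⟩
    rw [x.mem_cylinder_iff_isInitial
      (n := Λ.deg f + Pi.single i 1) (by rw [Λ.deg_comp, x.deg_mor, add_tsub_cancel_left])]
    rw [← x.mor_comp 0 _ _ zero_le hle]
    simp only [hx']
    exact .refl _
  · rintro ⟨e, he⟩
    have hle : Λ.deg f ≤ Λ.deg (Λ.comp f e.2.1 e.2.2.2.1.symm) := by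
      rw [Λ.deg_comp]; exact le_self_add
    rw [x.mem_cylinder_iff_isInitial hle]
    rw [x.mem_cylinder_iff] at he
    rw [he]
    exact isInitial_comp _ _ _

theorem pairwise_disjoint_cylinder_comp (f : Λ.Mor) (i : Fin k) :
    Pairwise (Function.onFun Disjoint
      fun e : Λ.EdgesFrom i (Λ.s f) => cylinder (Λ.comp f e.2.1 e.2.2.2.1.symm)) := by
  rintro ⟨w, e, he⟩ ⟨w', e', he'⟩ hne
  refine Set.disjoint_left.2 fun x hx hx' => hne ?_
  have h1 : x.mor 0 _ zero_le = Λ.comp f e he.2.1.symm := hx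
  have h2 : x.mor 0 _ zero_le = Λ.comp f e' he'.2.1.symm := hx'
  have hd : Λ.deg (Λ.comp f e he.2.1.symm) = Λ.deg (Λ.comp f e' he'.2.1.symm) := by
    rw [Λ.deg_comp, Λ.deg_comp, he.1, he'.1]
  simp only [hd] at h1
  obtain ⟨-, rfl⟩ := comp_inj (h1.symm.trans h2) rfl
  obtain rfl : w = w' := he.2.2.symm.trans he'.2.2
  rfl

variable [Λ.IsFinite]

theorem IsPerronFrobenius.apply_cylinder_of_edgesFrom {x : Λ.Obj → ℝ}
    (hx : Λ.IsPerronFrobenius x) (hρ : ∀ i, 0 < Λ.rho i) {M : Measure Λ.InfPath} {f : Λ.Mor}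
    {i : Fin k} (hM : ∀ e : Λ.EdgesFrom i (Λ.s f), M (cylinder (Λ.comp f e.2.1 e.2.2.2.1.symm))
      = ENNReal.ofReal ((Λ.rhoPow (Λ.deg f + Pi.single i 1))⁻¹ * x e.1)) :
    M (cylinder f) = ENNReal.ofReal ((Λ.rhoPow (Λ.deg f))⁻¹ * x (Λ.s f)) := by
  have := Fintype.ofFinite (Λ.EdgesFrom i (Λ.s f))
  have hnonneg (e : Λ.EdgesFrom i (Λ.s f)) :
      0 ≤ (Λ.rhoPow (Λ.deg f + Pi.single i 1))⁻¹ * x e.1 :=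
    mul_nonneg (inv_nonneg.2 (rhoPow_pos hρ _).le) (hx.pos _).le
  rw [cylinder_eq_iUnion_edgesFrom f i, measure_iUnion (pairwise_disjoint_cylinder_comp f i)
    fun e => (isOpen_cylinder _).measurableSet, tsum_fintype]
  simp only [hM]
  rw [← ENNReal.ofReal_sum_of_nonneg fun e _ => hnonneg e, hx.sum_inv_rhoPow_mul hρ]

variable [NeZero k]

theorem measurableSet_pathCylinder (γ : Λ.bratteli.FinPath) :
    MeasurableSet (pathCylinder γ) := (isOpen_pathCylinder γ).measurableSet

theorem pathCylinder_snoc_subset (γ : Λ.bratteli.FinPath) (e : γ.Ext) :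
    pathCylinder (γ.snoc e.2) ⊆ pathCylinder γ :=
  Set.preimage_mono (BratteliDiagram.cylinder_snoc_subset γ e)

theorem exists_mem_pathCylinder_snoc {γ : Λ.bratteli.FinPath} {x : Λ.InfPath}
    (hx : x ∈ pathCylinder γ) : ∃ e : γ.Ext, x ∈ pathCylinder (γ.snoc e.2) :=
  BratteliDiagram.exists_mem_cylinder_snoc hx

theorem ext_eq_of_mem_pathCylinder {γ : Λ.bratteli.FinPath} {e e' : γ.Ext} {x : Λ.InfPath}
    (h : x ∈ pathCylinder (γ.snoc e.2)) (h' : x ∈ pathCylinder (γ.snoc e'.2)) : e = e' :=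
  BratteliDiagram.ext_eq_of_mem_cylinder h h'

theorem disjoint_pathCylinder {γ η : Λ.bratteli.FinPath} (hl : γ.len = η.len) (hne : γ ≠ η) :
    Disjoint (pathCylinder γ) (pathCylinder η) :=
  Set.disjoint_left.2 fun _ hγ hη => hne (BratteliDiagram.eq_of_mem_cylinder hγ hη hl)

theorem disjoint_pathCylinder_snoc (γ : Λ.bratteli.FinPath) {e e' : γ.Ext} (hne : e ≠ e') :
    Disjoint (pathCylinder (γ.snoc e.2)) (pathCylinder (γ.snoc e'.2)) :=
  disjoint_pathCylinder rfl fun h => hne (γ.snoc_injective h)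

theorem pathCylinder_eq_iUnion (γ : Λ.bratteli.FinPath) :
    pathCylinder γ = ⋃ e : γ.Ext, pathCylinder (γ.snoc e.2) :=
  Set.Subset.antisymm (fun _ hx => Set.mem_iUnion.2 (exists_mem_pathCylinder_snoc hx))
    (Set.iUnion_subset (pathCylinder_snoc_subset γ))

theorem pathCylinder_subset_or_disjoint {γ η : Λ.bratteli.FinPath} (hl : γ.len ≤ η.len) :
    pathCylinder η ⊆ pathCylinder γ ∨ Disjoint (pathCylinder η) (pathCylinder γ) := by
  by_cases h : Disjoint (pathCylinder η) (pathCylinder γ)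
  · exact .inr h
  · obtain ⟨x, hη, hγ⟩ := Set.not_disjoint_iff.1 h
    exact .inl (Set.preimage_mono (BratteliDiagram.cylinder_subset_of_mem hγ hη hl))

/-- A vertex, as a path of the diagram. -/
def vertexPath (v : Λ.Obj) : Λ.bratteli.FinPath :=
  BratteliDiagram.FinPath.vertex (B := Λ.bratteli) v

theorem vertexPath_injective {v w : Λ.Obj} (h : vertexPath v = vertexPath w) : v = w := by
  have h' : (BratteliDiagram.FinPath.vertex v : Λ.bratteli.FinPath) = .vertex w := h
  injection h'

theorem disjoint_vertexPath {v w : Λ.Obj} (hne : v ≠ w) :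
    Disjoint (pathCylinder (vertexPath v)) (pathCylinder (vertexPath w)) :=
  disjoint_pathCylinder rfl fun h => hne (vertexPath_injective h)

theorem exists_mem_vertexPath (x : Λ.InfPath) : ∃ v, x ∈ pathCylinder (vertexPath v) :=
  ⟨x.toBratteli.vert 0, rfl⟩

variable (Λ) in
theorem univ_eq_iUnion_vertexPath :
    (Set.univ : Set Λ.InfPath) = ⋃ v : Λ.Obj, pathCylinder (vertexPath v) :=
  (Set.iUnion_eq_univ_iff.2 exists_mem_vertexPath).symm

/-! ## Infinite paths of a `k`-graph from infinite paths of its diagram -/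

theorem isInitial_pathMor_trunc (y : Λ.bratteli.InfPath) {m n : ℕ} (h : m ≤ n) :
    IsInitial (pathMor (y.trunc m)) (pathMor (y.trunc n)) := by
  induction n, h using Nat.le_induction with
  | base => exact .refl _
  | succ n _ ih => exact ih.trans (isInitial_comp _ _ _)

theorem exists_initialMor (y : Λ.bratteli.InfPath) (n : Fin k → ℕ) :
    ∃ f : Λ.Mor, Λ.deg f = n ∧ ∃ N, IsInitial f (pathMor (y.trunc N)) := by
  obtain ⟨N, hN⟩ := exists_le_rainbow n
  have hd : Λ.deg (pathMor (y.trunc N)) = rainbow k N := deg_pathMor _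
  obtain ⟨f, hf, hfi⟩ := exists_isInitial (hN.trans hd.ge)
  exact ⟨f, hf, N, hfi⟩

/-- The initial segment of degree `n` of an infinite path of the diagram. -/
noncomputable def initialMor (y : Λ.bratteli.InfPath) (n : Fin k → ℕ) : Λ.Mor :=
  (exists_initialMor y n).choose

theorem deg_initialMor (y : Λ.bratteli.InfPath) (n : Fin k → ℕ) :
    Λ.deg (initialMor y n) = n := (exists_initialMor y n).choose_spec.1

theorem exists_isInitial_initialMor (y : Λ.bratteli.InfPath) (n : Fin k → ℕ) :
    ∃ N, ∀ N', N ≤ N' → IsInitial (initialMor y n) (pathMor (y.trunc N')) := by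
  obtain ⟨N, hN⟩ := (exists_initialMor y n).choose_spec.2
  exact ⟨N, fun N' h => hN.trans (isInitial_pathMor_trunc y h)⟩

theorem isInitial_initialMor (y : Λ.bratteli.InfPath) {m n : Fin k → ℕ} (h : m ≤ n) :
    IsInitial (initialMor y m) (initialMor y n) := by
  obtain ⟨M, hM⟩ := exists_isInitial_initialMor y m
  obtain ⟨N, hN⟩ := exists_isInitial_initialMor y n
  exact (hM _ (le_max_left M N)).of_deg_le (hN _ (le_max_right M N))
    (by rwa [deg_initialMor, deg_initialMor])

theorem initialMor_rainbow (y : Λ.bratteli.InfPath) (n : ℕ) :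
    initialMor y (rainbow k n) = pathMor (y.trunc n) := by
  obtain ⟨N, hN⟩ := exists_isInitial_initialMor y (rainbow k n)
  refine (hN _ (le_max_left N n)).eq_of_deg_eq
    (isInitial_pathMor_trunc y (le_max_right N n)) ?_
  rw [deg_initialMor, deg_pathMor]
  rfl

/-- The segment from `m` to `n` of an infinite path of the diagram. -/
noncomputable def segment (y : Λ.bratteli.InfPath) (m n : Fin k → ℕ) (h : m ≤ n) : Λ.Mor :=
  (isInitial_initialMor y h).choose

theorem s_initialMor_eq (y : Λ.bratteli.InfPath) (m n : Fin k → ℕ) (h : m ≤ n) :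
    Λ.s (initialMor y m) = Λ.r (segment y m n h) :=
  (isInitial_initialMor y h).choose_spec.choose

theorem initialMor_comp_segment (y : Λ.bratteli.InfPath) (m n : Fin k → ℕ) (h : m ≤ n) :
    Λ.comp (initialMor y m) (segment y m n h) (s_initialMor_eq y m n h) = initialMor y n :=
  (isInitial_initialMor y h).choose_spec.choose_spec

theorem s_segment (y : Λ.bratteli.InfPath) (m n : Fin k → ℕ) (h : m ≤ n) :
    Λ.s (segment y m n h) = Λ.s (initialMor y n) := by
  rw [← initialMor_comp_segment y m n h, Λ.s_comp]

/-- The infinite path of `Λ` with a given sequence of edges in the diagram. -/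
noncomputable def ofBratteli (y : Λ.bratteli.InfPath) : Λ.InfPath where
  obj n := Λ.s (initialMor y n)
  mor := segment y
  r_mor m n h := (s_initialMor_eq y m n h).symm
  s_mor := s_segment y
  mor_self m :=
    (comp_inj ((initialMor_comp_segment y m m le_rfl).trans (Λ.comp_one _).symm) rfl).2
  mor_comp m n p h h' := by
    refine (comp_inj (f := initialMor y m) (f' := initialMor y m)
      (h := (s_initialMor_eq y m n h).trans (Λ.r_comp _ _ _).symm)
      (h' := s_initialMor_eq y m p _) ?_ rfl).2
    rw [initialMor_comp_segment, ← Λ.assoc _ _ _ (s_initialMor_eq y m n h)]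
    simp only [initialMor_comp_segment]
  deg_mor m n h := by
    have h1 := congrArg Λ.deg (initialMor_comp_segment y m n h)
    rw [Λ.deg_comp, deg_initialMor, deg_initialMor] at h1
    funext i
    have h2 := congrFun h1 i
    simp only [Pi.add_apply, Pi.sub_apply] at h2 ⊢
    omega

theorem ofBratteli_mor_zero (y : Λ.bratteli.InfPath) (n : Fin k → ℕ) :
    (ofBratteli y).mor 0 n zero_le = initialMor y n := by
  rw [← initialMor_comp_segment y 0 n zero_le,
    comp_eq_of_deg_eq_zero (deg_initialMor y 0)]
  rfl

theorem ofBratteli_mem_pathCylinder {y : Λ.bratteli.InfPath} {γ : Λ.bratteli.FinPath} :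
    ofBratteli y ∈ pathCylinder γ ↔ y ∈ BratteliDiagram.cylinder γ := by
  rw [mem_pathCylinder_iff, ofBratteli_mor_zero, initialMor_rainbow]
  exact ⟨fun h => pathMor_injective h rfl, fun h => congrArg pathMor h⟩

/-! ## The measure on the infinite path space -/

theorem cylinder_eq_biUnion (f : Λ.Mor) :
    cylinder f = ⋃ γ ∈ {γ : Λ.bratteli.FinPath | pathCylinder γ ⊆ cylinder f},
      pathCylinder γ := by
  refine Set.Subset.antisymm (fun x hx => ?_) (Set.iUnion₂_subset fun γ hγ => hγ)
  obtain ⟨N, hN⟩ := exists_le_rainbow (Λ.deg f)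
  refine Set.mem_biUnion (x := x.toBratteli.trunc N) (fun y hy => ?_)
    (x.toBratteli.mem_cylinder_trunc N)
  rw [InfPath.mem_cylinder_iff_isInitial _ hN] at hx ⊢
  rwa [← InfPath.pathMor_trunc,
    show y.toBratteli.trunc N = x.toBratteli.trunc N from hy, InfPath.pathMor_trunc]

variable (Λ) in
theorem measurableSpace_eq_generateFrom : instMeasInfPath Λ =
    MeasurableSpace.generateFrom (Set.range (pathCylinder (Λ := Λ))) := by
  have := Λ.countable
  have hc : (Set.range (cylinder (Λ := Λ))).Countable := Set.countable_range _
  have : SecondCountableTopology Λ.InfPath := ⟨_, hc, rfl⟩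
  refine le_antisymm ?_ (MeasurableSpace.generateFrom_le ?_)
  · rw [instMeasInfPath,
      borel_eq_generateFrom_of_subbasis (s := Set.range (cylinder (Λ := Λ))) rfl]
    refine MeasurableSpace.generateFrom_le ?_
    rintro _ ⟨f, rfl⟩
    rw [cylinder_eq_biUnion f]
    exact MeasurableSet.biUnion (Set.to_countable _) fun γ _ =>
      MeasurableSpace.measurableSet_generateFrom ⟨γ, rfl⟩
  · rintro _ ⟨γ, rfl⟩
    exact (isOpen_pathCylinder γ).measurableSet

theorem measurable_ofBratteli : Measurable (ofBratteli (Λ := Λ)) := by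
  rw [measurableSpace_eq_generateFrom Λ]
  refine measurable_generateFrom ?_
  rintro _ ⟨γ, rfl⟩
  have hγ : ofBratteli ⁻¹' pathCylinder γ = BratteliDiagram.cylinder γ :=
    Set.ext fun _ => ofBratteli_mem_pathCylinder
  rw [hγ]
  exact MeasurableSpace.measurableSet_generateFrom ⟨γ, rfl⟩

theorem IsPerronFrobenius.exists_measure_pathCylinder_eq {x : Λ.Obj → ℝ}
    (hx : Λ.IsPerronFrobenius x) (hρ : ∀ i, 0 < Λ.rho i) :
    ∃ M : Measure Λ.InfPath, ∀ γ : Λ.bratteli.FinPath, M (pathCylinder γ)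
      = ENNReal.ofReal ((Λ.rhoPow (rainbow k γ.len))⁻¹ * x γ.src) := by
  have hm (γ : Λ.bratteli.FinPath) : 0 < (Λ.rhoPow (rainbow k γ.len))⁻¹ * x γ.src :=
    mul_pos (inv_pos.2 (rhoPow_pos hρ _)) (hx.pos _)
  have hadd (γ : Λ.bratteli.FinPath) :
      ∑ e : γ.Ext, (Λ.rhoPow (rainbow k (γ.len + 1)))⁻¹ * x e.1
        = (Λ.rhoPow (rainbow k γ.len))⁻¹ * x γ.src := by
    rw [rainbow_succ]
    let : Fintype (Λ.EdgesFrom (Fin.ofNat k γ.len) γ.src) :=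
      BratteliDiagram.instFintypeExt γ
    exact hx.sum_inv_rhoPow_mul hρ _ _ _
  obtain ⟨μ, hμ⟩ := BratteliDiagram.exists_measure_cylinder_eq (B := Λ.bratteli)
    (m := fun γ => Real.toNNReal ((Λ.rhoPow (rainbow k γ.len))⁻¹ * x γ.src))
    (fun γ => Real.toNNReal_pos.2 (hm γ)) fun γ => by
      rw [← hadd γ, Real.toNNReal_sum_of_nonneg fun e _ => (hm (γ.snoc e.2)).le]
      rfl
  refine ⟨μ.map ofBratteli, fun γ => ?_⟩
  rw [Measure.map_apply measurable_ofBratteli (isOpen_pathCylinder γ).measurableSet]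
  exact (congrArg μ (Set.ext fun _ => ofBratteli_mem_pathCylinder)).trans (hμ γ)

-- Induction on the degree `c` that `f` still lacks to be a path of the diagram.
theorem IsPerronFrobenius.apply_cylinder_of_apply_pathCylinder {x : Λ.Obj → ℝ}
    (hx : Λ.IsPerronFrobenius x) (hρ : ∀ i, 0 < Λ.rho i) {M : Measure Λ.InfPath}
    (hM : ∀ γ : Λ.bratteli.FinPath, M (pathCylinder γ)
      = ENNReal.ofReal ((Λ.rhoPow (rainbow k γ.len))⁻¹ * x γ.src)) (f : Λ.Mor) :
    M (cylinder f) = ENNReal.ofReal ((Λ.rhoPow (Λ.deg f))⁻¹ * x (Λ.s f)) := by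
  obtain ⟨N, hN⟩ := exists_le_rainbow (Λ.deg f)
  obtain ⟨c, hc⟩ := exists_add_of_le hN
  induction c using WellFoundedLT.induction generalizing f with | ind c ih =>
  by_cases hc0 : c = 0
  · obtain ⟨γ, rfl, rfl⟩ := exists_pathMor_eq (f := f) (n := N) (by rw [hc, hc0, add_zero])
    rw [← pathCylinder_eq_cylinder, hM, deg_pathMor, s_pathMor]
  · obtain ⟨i, hi⟩ := Function.ne_iff.1 hc0
    obtain ⟨b, rfl⟩ : ∃ b, c = Pi.single i 1 + b := exists_add_of_le <|
      update_le_iff.2 ⟨Nat.one_le_iff_ne_zero.2 hi, fun _ _ => zero_le⟩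
    refine hx.apply_cylinder_of_edgesFrom hρ (i := i) fun e => ?_
    have hdeg : Λ.deg (Λ.comp f e.2.1 e.2.2.2.1.symm) = Λ.deg f + Pi.single i 1 := by
      rw [Λ.deg_comp, e.2.2.1]
    have hN' : rainbow k N = Λ.deg f + Pi.single i 1 + b := hc.trans (add_assoc _ _ _).symm
    have hlt : b < Pi.single i 1 + b :=
      lt_add_of_pos_left b (Pi.single_pos.2 one_pos)
    rw [ih b hlt _ (by rw [hdeg, hN']; exact le_self_add) (by rw [hdeg, hN']), hdeg, Λ.s_comp,
      e.2.2.2.2]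

theorem isPathMeasure_measure (hx : ∃ x, Λ.IsPerronFrobenius x) (hρ : ∀ i, 0 < Λ.rho i) :
    Λ.IsPathMeasure Λ.measure := by
  have hperron := isPerronFrobenius_perron hx
  obtain ⟨M, hM⟩ := hperron.exists_measure_pathCylinder_eq hρ
  have huniv : M Set.univ = 1 := by
    rw [univ_eq_iUnion_vertexPath, measure_iUnion (fun _ _ hne => disjoint_vertexPath hne)
      (fun v => measurableSet_pathCylinder _), tsum_fintype]
    have hv (v : Λ.Obj) : M (pathCylinder (vertexPath v)) = ENNReal.ofReal (Λ.perron v) := by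
      rw [hM, show rainbow k (vertexPath v).len = 0 from rainbow_zero k, rhoPow_zero, inv_one,
        one_mul]
      rfl
    simp only [hv]
    rw [← ENNReal.ofReal_sum_of_nonneg fun v _ => (hperron.pos v).le, hperron.sum_eq,
      ENNReal.ofReal_one]
  have h : ∃ M, Λ.IsPathMeasure M :=
    ⟨M, ⟨huniv⟩, hperron.apply_cylinder_of_apply_pathCylinder hρ hM⟩
  rw [measure, dif_pos h]
  exact h.choose_spec

end KGraph

theorem smul_mem_span_sum_sup {𝕜 ι V : Type*} [Field 𝕜] [Fintype ι] [AddCommGroup V] [Module 𝕜 V]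
    {E : Submodule 𝕜 V} {m : ι → 𝕜} {u : ι → V} (hm : ∑ i, m i ≠ 0)
    (hE : ∀ i j, i ≠ j → u i - u j ∈ E) (i : ι) :
    m i • u i ∈ Submodule.span 𝕜 {∑ j, m j • u j} ⊔ E := by
  have hsum : m i • u i = (m i / ∑ j, m j) • ∑ j, m j • u j +
      ∑ j, (m i * m j / ∑ j, m j) • (u i - u j) := by
    simp only [smul_sub, Finset.sum_sub_distrib, ← Finset.sum_smul, ← Finset.sum_div,
      ← Finset.mul_sum, Finset.smul_sum, smul_smul, div_mul_eq_mul_div]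
    rw [mul_div_assoc, div_self hm, mul_one]
    abel
  rw [hsum]
  refine add_mem (Submodule.mem_sup_left (Submodule.smul_mem _ _
    (Submodule.mem_span_singleton_self _))) (Submodule.mem_sup_right
      (Submodule.sum_mem _ fun j _ => Submodule.smul_mem _ _ ?_))
  by_cases h : i = j
  · rw [h, sub_self]
    exact zero_mem _
  · exact hE i j h

namespace KGraph

variable {k : ℕ} {Λ : KGraph.{u} k} [Λ.IsFinite]

/-! ## Characteristic functions -/

theorem chi_eq_sum {ι : Type*} [Fintype ι] {S : Set Λ.InfPath} (hS : MeasurableSet S)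
    {T : ι → Set Λ.InfPath} (hT : ∀ i, MeasurableSet (T i))
    (hd : Pairwise (Function.onFun Disjoint T)) (h : S = ⋃ i, T i) :
    chi hS = ∑ i, chi (hT i) := by
  classical
  have hfinset : ∀ s : Finset ι, chi (Finset.measurableSet_biUnion s fun i _ => hT i)
      = ∑ i ∈ s, chi (hT i) := by
    intro s
    induction s using Finset.induction_on with
    | empty =>
      simp only [chi, Finset.notMem_empty, Set.iUnion_false, Set.iUnion_empty,
        Finset.sum_empty, indicatorConstLp_empty]
    | insert i s hi ih =>
      rw [Finset.sum_insert hi, ← ih]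
      simp only [chi, Finset.set_biUnion_insert]
      refine indicatorConstLp_disjoint_union _ _ _ _ ?_ _
      rw [Set.disjoint_iUnion₂_right]
      exact fun j hj => hd fun h => hi (h ▸ hj)
  rw [← hfinset Finset.univ]
  simp only [h, Finset.mem_univ, Set.iUnion_true]

theorem inner_chi {S T : Set Λ.InfPath} (hS : MeasurableSet S) (hT : MeasurableSet T) :
    inner ℂ (chi hS) (chi hT) = (Λ.measure.real (S ∩ T) : ℂ) :=
  L2.inner_indicatorConstLp_one_indicatorConstLp_one hS hT

theorem inner_chi_eq_zero {S T : Set Λ.InfPath} (hS : MeasurableSet S) (hT : MeasurableSet T)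
    (h : Disjoint S T) : inner ℂ (chi hS) (chi hT) = 0 := by
  rw [inner_chi, h.inter_eq, measureReal_empty, Complex.ofReal_zero]

variable [NeZero k]

/-- The measure of a cylinder set. -/
noncomputable def mass (γ : Λ.bratteli.FinPath) : ℝ := Λ.measure.real (pathCylinder γ)

theorem sum_mass_snoc (γ : Λ.bratteli.FinPath) :
    ∑ e : γ.Ext, mass (γ.snoc e.2) = mass γ := by
  conv_rhs => rw [mass, pathCylinder_eq_iUnion]
  rw [measureReal_iUnion_fintype (fun e e' h => disjoint_pathCylinder_snoc γ h)
    fun e => measurableSet_pathCylinder _]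
  rfl

theorem sum_mass_vertexPath [IsProbabilityMeasure Λ.measure] :
    ∑ v : Λ.Obj, mass (vertexPath v) = 1 := by
  rw [← probReal_univ (μ := Λ.measure), univ_eq_iUnion_vertexPath,
    measureReal_iUnion_fintype (fun e e' h => disjoint_vertexPath h)
    fun e => measurableSet_pathCylinder _]
  rfl

theorem mass_pos (hM : Λ.IsPathMeasure Λ.measure) (hx : Λ.IsPerronFrobenius Λ.perron)
    (hρ : ∀ i, 0 < Λ.rho i) (γ : Λ.bratteli.FinPath) : 0 < mass γ := by
  have hpos := mul_pos (inv_pos.2 (rhoPow_pos hρ (Λ.deg (pathMor γ)))) (hx.pos (Λ.s (pathMor γ)))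
  rwa [mass, pathCylinder_eq_cylinder, Measure.real, hM.apply_cylinder,
    ENNReal.toReal_ofReal hpos.le]

theorem chiPath_eq_sum (γ : Λ.bratteli.FinPath) :
    chiPath γ = ∑ e : γ.Ext, chiPath (γ.snoc e.2) :=
  chi_eq_sum _ _ (fun _ _ h => disjoint_pathCylinder_snoc γ h) (pathCylinder_eq_iUnion γ)

variable (Λ) in
theorem chi_univ_eq_sum :
    chi (MeasurableSet.univ (α := Λ.InfPath)) = ∑ v : Λ.Obj, chiPath (vertexPath v) :=
  chi_eq_sum _ _ (fun _ _ h => disjoint_vertexPath h) (univ_eq_iUnion_vertexPath Λ)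

theorem inner_chi_chiNormalized_of_subset {S : Set Λ.InfPath} (hS : MeasurableSet S)
    {γ : Λ.bratteli.FinPath} (hpos : 0 < mass γ) (h : pathCylinder γ ⊆ S) :
    inner ℂ (chi hS) (chiNormalized γ) = 1 := by
  rw [chiNormalized, inner_smul_right, chiPath, inner_chi, Set.inter_eq_right.2 h]
  exact inv_mul_cancel₀ (Complex.ofReal_ne_zero.2 hpos.ne')

theorem inner_chi_chiNormalized_of_disjoint {S : Set Λ.InfPath} (hS : MeasurableSet S)
    {γ : Λ.bratteli.FinPath} (h : Disjoint S (pathCylinder γ)) :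
    inner ℂ (chi hS) (chiNormalized γ) = 0 := by
  rw [chiNormalized, inner_smul_right, chiPath, inner_chi_eq_zero _ _ h, mul_zero]

theorem mass_smul_chiNormalized {γ : Λ.bratteli.FinPath} (hpos : 0 < mass γ) :
    (mass γ : ℂ) • chiNormalized γ = chiPath γ := by
  rw [chiNormalized, smul_smul]
  exact (congrArg (· • chiPath γ) (mul_inv_cancel₀ (Complex.ofReal_ne_zero.2 hpos.ne'))).trans
    (one_smul _ _)

/-! ## The wavelet decomposition -/

variable (Λ) in
/-- The span of the characteristic functions of the paths of length `m`. -/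
noncomputable def levelSpace (m : ℕ) : Submodule ℂ Λ.L2 :=
  Submodule.span ℂ {φ | ∃ γ : Λ.bratteli.FinPath, γ.len = m ∧ φ = chiPath γ}

theorem chiPath_mem_levelSpace (γ : Λ.bratteli.FinPath) : chiPath γ ∈ Λ.levelSpace γ.len :=
  Submodule.subset_span ⟨γ, rfl, rfl⟩

theorem chiPath_eq_chiMor (γ : Λ.bratteli.FinPath) : chiPath γ = chiMor (pathMor γ) := by
  simp only [chiPath, chiMor, chi, pathCylinder_eq_cylinder]

theorem scalingSpace_eq_levelSpace (n : ℕ) : Λ.scalingSpace n = Λ.levelSpace (n * k) := by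
  refine le_antisymm (Submodule.span_mono ?_) (Submodule.span_mono ?_)
  · rintro _ ⟨f, hf, rfl⟩
    obtain ⟨γ, hγ, rfl⟩ := exists_pathMor_eq (hf.trans (rainbow_mul k n).symm)
    exact ⟨γ, hγ, (chiPath_eq_chiMor γ).symm⟩
  · rintro _ ⟨γ, hγ, rfl⟩
    exact ⟨pathMor γ, by rw [deg_pathMor, hγ, rainbow_mul], chiPath_eq_chiMor γ⟩

theorem levelSpace_le_succ (m : ℕ) : Λ.levelSpace m ≤ Λ.levelSpace (m + 1) := by
  refine Submodule.span_le.2 ?_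
  rintro _ ⟨γ, rfl, rfl⟩
  rw [chiPath_eq_sum]
  exact Submodule.sum_mem _ fun e _ => chiPath_mem_levelSpace (γ.snoc e.2)

variable (Λ) in
theorem levelSpace_mono : Monotone Λ.levelSpace := monotone_nat_of_le_succ levelSpace_le_succ

theorem eigenspacePath_le (γ : Λ.bratteli.FinPath) :
    Λ.eigenspacePath γ ≤ Λ.levelSpace (γ.len + 1) := by
  refine Submodule.span_le.2 ?_
  rintro _ ⟨e, e', -, rfl⟩
  exact sub_mem (Submodule.smul_mem _ _ (chiPath_mem_levelSpace (γ.snoc e.2)))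
    (Submodule.smul_mem _ _ (chiPath_mem_levelSpace (γ.snoc e'.2)))

section Decomposition

variable (hpos : ∀ γ : Λ.bratteli.FinPath, 0 < mass γ)
include hpos

theorem levelSpace_isOrtho_eigenspacePath {m : ℕ} {γ : Λ.bratteli.FinPath} (h : m ≤ γ.len) :
    Λ.levelSpace m ⟂ Λ.eigenspacePath γ := by
  refine Submodule.isOrtho_span.2 ?_
  rintro _ ⟨η, rfl, rfl⟩ _ ⟨e, e', -, rfl⟩
  rw [inner_sub_right, sub_eq_zero, chiPath]
  rcases pathCylinder_subset_or_disjoint h with hsub | hdisj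
  · rw [inner_chi_chiNormalized_of_subset _ (hpos _) ((pathCylinder_snoc_subset γ e).trans hsub),
      inner_chi_chiNormalized_of_subset _ (hpos _) ((pathCylinder_snoc_subset γ e').trans hsub)]
  · have hzero (e : γ.Ext) := inner_chi_chiNormalized_of_disjoint (measurableSet_pathCylinder η)
      (hdisj.symm.mono_right (pathCylinder_snoc_subset γ e))
    rw [hzero, hzero]

theorem eigenspacePath_isOrtho {γ η : Λ.bratteli.FinPath} (hne : γ ≠ η) :
    Λ.eigenspacePath γ ⟂ Λ.eigenspacePath η := by
  rcases lt_trichotomy γ.len η.len with h | h | h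
  · exact (levelSpace_isOrtho_eigenspacePath hpos h).mono_left (eigenspacePath_le γ)
  · refine Submodule.isOrtho_span.2 ?_
    have hzero : ∀ (e : γ.Ext) (e' : η.Ext),
        inner ℂ (chiNormalized (γ.snoc e.2)) (chiNormalized (η.snoc e'.2)) = 0 := by
      intro e e'
      rw [chiNormalized, inner_smul_left, chiPath, inner_chi_chiNormalized_of_disjoint, mul_zero]
      exact (disjoint_pathCylinder h hne).mono (pathCylinder_snoc_subset γ e)
        (pathCylinder_snoc_subset η e')
    rintro _ ⟨e₁, e₂, -, rfl⟩ _ ⟨e₃, e₄, -, rfl⟩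
    rw [inner_sub_left, inner_sub_right, inner_sub_right]
    simp only [hzero, sub_self]
  · exact ((levelSpace_isOrtho_eigenspacePath hpos h).mono_left (eigenspacePath_le η)).symm

theorem levelSpace_succ_le (m : ℕ) : Λ.levelSpace (m + 1) ≤
    Λ.levelSpace m ⊔ ⨆ γ ∈ {γ : Λ.bratteli.FinPath | γ.len = m}, Λ.eigenspacePath γ := by
  refine Submodule.span_le.2 ?_
  rintro _ ⟨ζ, hζ, rfl⟩
  obtain ⟨γ, e, rfl, rfl⟩ := BratteliDiagram.FinPath.exists_eq_snoc hζ
  have h := smul_mem_span_sum_sup (E := Λ.eigenspacePath γ)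
    (m := fun e : γ.Ext => (mass (γ.snoc e.2) : ℂ)) (u := fun e => chiNormalized (γ.snoc e.2))
    (by rw [← Complex.ofReal_sum, sum_mass_snoc]; exact Complex.ofReal_ne_zero.2 (hpos γ).ne')
    (fun e e' hne => Submodule.subset_span ⟨e, e', hne, rfl⟩) e
  simp only [mass_smul_chiNormalized (hpos _), ← chiPath_eq_sum] at h
  refine SetLike.le_def.1 (sup_le_sup ?_ ?_) h
  · rw [Submodule.span_singleton_le_iff_mem]
    exact chiPath_mem_levelSpace γ
  · exact le_iSup₂_of_le (f := fun γ (_ : γ ∈ _) => Λ.eigenspacePath γ) γ rfl le_rfl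

theorem levelSpace_add (m j : ℕ) : Λ.levelSpace (m + j) = Λ.levelSpace m ⊔
    ⨆ γ ∈ {γ : Λ.bratteli.FinPath | m ≤ γ.len ∧ γ.len < m + j}, Λ.eigenspacePath γ := by
  refine le_antisymm ?_ (sup_le (levelSpace_mono Λ (Nat.le_add_right m j))
    (iSup₂_le fun γ hγ => (eigenspacePath_le γ).trans (levelSpace_mono Λ hγ.2)))
  induction j with
  | zero => exact le_sup_left
  | succ j ih =>
    refine (levelSpace_succ_le hpos (m + j)).trans (sup_le (ih.trans (sup_le_sup le_rfl ?_))
      (le_sup_of_le_right ?_))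
    · exact biSup_mono fun γ hγ => ⟨hγ.1, hγ.2.trans (Nat.lt_succ_self _)⟩
    · refine biSup_mono fun γ (hγ : γ.len = m + j) => ⟨by omega, by omega⟩

theorem scalingSpace_succ (n : ℕ) : Λ.scalingSpace (n + 1) = Λ.scalingSpace n ⊔
    ⨆ γ ∈ {γ : Λ.bratteli.FinPath | n * k ≤ γ.len ∧ γ.len < (n + 1) * k},
      Λ.eigenspacePath γ := by
  rw [scalingSpace_eq_levelSpace, scalingSpace_eq_levelSpace, Nat.succ_mul, levelSpace_add hpos]

theorem waveletSpace_eq (n : ℕ) : Λ.waveletSpace n =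
    ⨆ γ ∈ {γ : Λ.bratteli.FinPath | n * k ≤ γ.len ∧ γ.len < (n + 1) * k},
      Λ.eigenspacePath γ := by
  have hle : (⨆ γ ∈ {γ : Λ.bratteli.FinPath | n * k ≤ γ.len ∧ γ.len < (n + 1) * k},
      Λ.eigenspacePath γ) ≤ (Λ.scalingSpace n)ᗮ := by
    refine iSup₂_le fun γ hγ => ?_
    rw [scalingSpace_eq_levelSpace]
    exact (levelSpace_isOrtho_eigenspacePath hpos hγ.1).symm
  rw [waveletSpace, scalingSpace_succ hpos, sup_comm, sup_inf_assoc_of_le _ hle,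
    Submodule.inf_orthogonal_eq_bot, sup_bot_eq]

theorem scalingSpace_succ_eq_sup (n : ℕ) :
    Λ.scalingSpace (n + 1) = Λ.scalingSpace n ⊔ Λ.waveletSpace n := by
  rw [waveletSpace_eq hpos, scalingSpace_succ hpos]

end Decomposition

variable (Λ) in
theorem scalingSpace_mono : Monotone Λ.scalingSpace := fun m n h => by
  rw [scalingSpace_eq_levelSpace, scalingSpace_eq_levelSpace]
  exact levelSpace_mono Λ (Nat.mul_le_mul_right k h)

theorem scalingSpace_isOrtho_waveletSpace {m n : ℕ} (h : m ≤ n) :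
    Λ.scalingSpace m ⟂ Λ.waveletSpace n :=
  (Submodule.isOrtho_iff_le.2 (le_refl _)).symm.mono (scalingSpace_mono Λ h) inf_le_right

theorem waveletSpace_isOrtho {m n : ℕ} (h : m ≠ n) : Λ.waveletSpace m ⟂ Λ.waveletSpace n := by
  wlog hlt : m < n generalizing m n
  · exact (this h.symm (lt_of_le_of_ne (not_lt.1 hlt) h.symm)).symm
  · exact (scalingSpace_isOrtho_waveletSpace hlt).mono_left inf_le_left

variable (Λ) in
theorem isPiSystem_range_pathCylinder : IsPiSystem (Set.range (pathCylinder (Λ := Λ))) := by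
  rintro _ ⟨γ, rfl⟩ _ ⟨η, rfl⟩ hne
  rcases le_total γ.len η.len with h | h
  · rcases pathCylinder_subset_or_disjoint h with h' | h'
    · exact ⟨η, (Set.inter_eq_right.2 h').symm⟩
    · exact absurd h'.symm.inter_eq hne.ne_empty
  · rcases pathCylinder_subset_or_disjoint h with h' | h'
    · exact ⟨γ, (Set.inter_eq_left.2 h').symm⟩
    · exact absurd h'.inter_eq hne.ne_empty

theorem eq_zero_of_inner_chiPath_eq_zero {φ : Λ.L2}
    (h : ∀ γ : Λ.bratteli.FinPath, inner ℂ (chiPath γ) φ = 0) : φ = 0 := by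
  have hint : Integrable φ Λ.measure := (Lp.memLp φ).integrable one_le_two
  have hset : ∀ {S : Set Λ.InfPath} (hS : MeasurableSet S),
      inner ℂ (chi hS) φ = ∫ x in S, φ x ∂Λ.measure := fun hS =>
    L2.inner_indicatorConstLp_one hS (measure_ne_top _ _) φ
  have huniv : ∫ x, φ x ∂Λ.measure = 0 := by
    rw [← setIntegral_univ, ← hset MeasurableSet.univ, chi_univ_eq_sum, sum_inner]
    exact Finset.sum_eq_zero fun v _ => h _
  have hall : ∀ S, MeasurableSet S → ∫ x in S, φ x ∂Λ.measure = 0 := by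
    refine MeasurableSpace.induction_on_inter (measurableSpace_eq_generateFrom Λ)
      (isPiSystem_range_pathCylinder Λ) (by simp) ?_ ?_ ?_
    · rintro _ ⟨γ, rfl⟩
      rw [← hset (measurableSet_pathCylinder γ)]
      exact h γ
    · intro S hS h0
      have := integral_add_compl hS hint
      rwa [h0, zero_add, huniv] at this
    · intro S hd hS h0
      rw [integral_iUnion hS hd hint.integrableOn]
      simp [h0]
  rw [Lp.eq_zero_iff_ae_eq_zero]
  exact hint.ae_eq_zero_of_forall_setIntegral_eq_zero fun S hS _ => hall S hS

theorem topologicalClosure_eq_top (hpos : ∀ γ : Λ.bratteli.FinPath, 0 < mass γ) :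
    (Λ.scalingSpace 0 ⊔ ⨆ n, Λ.waveletSpace n).topologicalClosure = ⊤ := by
  have hle : ∀ n, Λ.scalingSpace n ≤ Λ.scalingSpace 0 ⊔ ⨆ n, Λ.waveletSpace n := by
    intro n
    induction n with
    | zero => exact le_sup_left
    | succ n ih =>
      rw [scalingSpace_succ_eq_sup hpos]
      exact sup_le ih (le_sup_of_le_right (le_iSup Λ.waveletSpace n))
  rw [Submodule.topologicalClosure_eq_top_iff, Submodule.eq_bot_iff]
  intro φ hφ
  refine eq_zero_of_inner_chiPath_eq_zero fun γ => (Submodule.mem_orthogonal _ _).1 hφ _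
    (hle γ.len ?_)
  rw [scalingSpace_eq_levelSpace]
  exact levelSpace_mono Λ (Nat.le_mul_of_pos_right _ (NeZero.pos k)) (chiPath_mem_levelSpace γ)

section Root

variable (hpos : ∀ γ : Λ.bratteli.FinPath, 0 < mass γ)
include hpos

theorem eigenspaceConst_isOrtho_eigenspaceRoot : Λ.eigenspaceConst ⟂ Λ.eigenspaceRoot := by
  refine Submodule.isOrtho_span.2 ?_
  rintro _ rfl _ ⟨v, v', -, rfl⟩
  rw [inner_sub_right, inner_chi_chiNormalized_of_subset _ (hpos _) (Set.subset_univ _),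
    inner_chi_chiNormalized_of_subset _ (hpos _) (Set.subset_univ _), sub_self]

theorem scalingSpace_zero_eq [IsProbabilityMeasure Λ.measure] :
    Λ.scalingSpace 0 = Λ.eigenspaceConst ⊔ Λ.eigenspaceRoot := by
  have hv : ∀ v : Λ.Obj, chiPath (vertexPath v) ∈ Λ.levelSpace 0 := fun v =>
    chiPath_mem_levelSpace (vertexPath v)
  rw [scalingSpace_eq_levelSpace, zero_mul]
  refine le_antisymm (Submodule.span_le.2 ?_) (sup_le ?_ (Submodule.span_le.2 ?_))
  · rintro _ ⟨γ, hγ, rfl⟩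
    obtain ⟨v, rfl⟩ := BratteliDiagram.FinPath.exists_eq_vertex hγ
    have h := smul_mem_span_sum_sup (E := Λ.eigenspaceRoot)
      (m := fun v : Λ.Obj => (mass (vertexPath v) : ℂ)) (u := fun v => chiNormalized (vertexPath v))
      (by rw [← Complex.ofReal_sum, sum_mass_vertexPath]; simp)
      (fun v v' hne => Submodule.subset_span ⟨v, v', hne, rfl⟩) v
    simp only [mass_smul_chiNormalized (hpos _), ← chi_univ_eq_sum] at h
    exact h
  · rw [eigenspaceConst, Submodule.span_singleton_le_iff_mem, chi_univ_eq_sum]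
    exact Submodule.sum_mem _ fun v _ => hv v
  · rintro _ ⟨v, v', -, rfl⟩
    exact sub_mem (Submodule.smul_mem _ _ (hv v)) (Submodule.smul_mem _ _ (hv v'))

end Root

end KGraph

/-! ## The integrand of the Dirichlet form -/

section BoundedMeasurable

variable {X : Type*} [MeasurableSpace X] {f g : X → ℂ}

/-- Bounded measurable functions: a class of functions that contains the form domain, is closed
under pointwise products, and is integrable against every finite measure. -/
structure IsBoundedMeasurable (f : X → ℂ) : Prop where
  measurable : Measurable f
  bounded : ∃ C, ∀ x, ‖f x‖ ≤ C

namespace IsBoundedMeasurable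

theorem const (c : ℂ) : IsBoundedMeasurable fun _ : X => c :=
  ⟨measurable_const, ‖c‖, fun _ => le_rfl⟩

theorem add (hf : IsBoundedMeasurable f) (hg : IsBoundedMeasurable g) :
    IsBoundedMeasurable (f + g) := by
  obtain ⟨C, hC⟩ := hf.bounded
  obtain ⟨D, hD⟩ := hg.bounded
  exact ⟨hf.measurable.add hg.measurable, C + D,
    fun x => (norm_add_le _ _).trans (add_le_add (hC x) (hD x))⟩

theorem mul (hf : IsBoundedMeasurable f) (hg : IsBoundedMeasurable g) :
    IsBoundedMeasurable fun x => f x * g x := by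
  obtain ⟨C, hC⟩ := hf.bounded
  obtain ⟨D, hD⟩ := hg.bounded
  refine ⟨hf.measurable.mul hg.measurable, C * D, fun x => (norm_mul_le _ _).trans ?_⟩
  exact mul_le_mul (hC x) (hD x) (norm_nonneg _) ((norm_nonneg _).trans (hC x))

theorem conj (hf : IsBoundedMeasurable f) :
    IsBoundedMeasurable fun x => (starRingEnd ℂ) (f x) :=
  ⟨Complex.continuous_conj.measurable.comp hf.measurable,
    hf.bounded.imp fun _ hC x => (RCLike.norm_conj _).trans_le (hC x)⟩

theorem integrable (hf : IsBoundedMeasurable f) (μ : Measure X) [IsFiniteMeasure μ] :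
    Integrable f μ := by
  obtain ⟨C, hC⟩ := hf.bounded
  exact Integrable.of_bound hf.measurable.aestronglyMeasurable C (.of_forall hC)

end IsBoundedMeasurable

/-- The function `(x, y) ↦ conj (g x - g y) (f x - f y)`. The trace of a block of the Dirichlet form
is a multiple of it. -/
noncomputable def differenceProduct (g f : X → ℂ) (p : X × X) : ℂ :=
  (starRingEnd ℂ) (g p.1 - g p.2) * (f p.1 - f p.2)

omit [MeasurableSpace X] in
theorem differenceProduct_eq (g f : X → ℂ) (p : X × X) : differenceProduct g f p =
    (starRingEnd ℂ) (g p.1) * f p.1 * 1 - (starRingEnd ℂ) (g p.1) * f p.2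
      - f p.1 * (starRingEnd ℂ) (g p.2) + 1 * ((starRingEnd ℂ) (g p.2) * f p.2) := by
  rw [differenceProduct, map_sub]
  ring

theorem IsBoundedMeasurable.differenceProduct (hg : IsBoundedMeasurable g)
    (hf : IsBoundedMeasurable f) : IsBoundedMeasurable (differenceProduct g f) := by
  have hsub {h : X → ℂ} (hh : IsBoundedMeasurable h) :
      IsBoundedMeasurable fun p : X × X => h p.1 - h p.2 := by
    obtain ⟨C, hC⟩ := hh.bounded
    exact ⟨(hh.measurable.comp measurable_fst).sub (hh.measurable.comp measurable_snd), C + C,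
      fun p => (norm_sub_le _ _).trans (add_le_add (hC _) (hC _))⟩
  exact (hsub hg).conj.mul (hsub hf)

theorem integral_differenceProduct_prod (μ ν : Measure X) [IsFiniteMeasure μ] [IsFiniteMeasure ν]
    (hg : IsBoundedMeasurable g) (hf : IsBoundedMeasurable f) :
    ∫ p, differenceProduct g f p ∂(μ.prod ν) =
      (∫ x, (starRingEnd ℂ) (g x) * f x ∂μ) * ν.real Set.univ
      - (∫ x, (starRingEnd ℂ) (g x) ∂μ) * (∫ x, f x ∂ν)
      - (∫ x, f x ∂μ) * (∫ x, (starRingEnd ℂ) (g x) ∂ν)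
      + μ.real Set.univ * (∫ x, (starRingEnd ℂ) (g x) * f x ∂ν) := by
  have hint {a b : X → ℂ} (ha : IsBoundedMeasurable a) (hb : IsBoundedMeasurable b) :
      Integrable (fun p : X × X => a p.1 * b p.2) (μ.prod ν) :=
    (ha.integrable _).mul_prod (hb.integrable _)
  have h₁ := hint (hg.conj.mul hf) (.const 1)
  have h₂ := hint hg.conj hf
  have h₃ := hint hf hg.conj
  have h₄ := hint (.const 1) (hg.conj.mul hf)
  simp only [differenceProduct_eq]
  rw [integral_add (by exact (h₁.sub h₂).sub h₃) h₄, integral_sub (by exact h₁.sub h₂) h₃,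
    integral_sub h₁ h₂,
    integral_prod_mul (fun x => (starRingEnd ℂ) (g x) * f x) (fun _ => 1),
    integral_prod_mul (fun x => (starRingEnd ℂ) (g x)) f,
    integral_prod_mul f (fun x => (starRingEnd ℂ) (g x)),
    integral_prod_mul (fun _ => 1) (fun x => (starRingEnd ℂ) (g x) * f x)]
  simp only [integral_const, Complex.real_smul, mul_one]

end BoundedMeasurable

/-- The submodule of functions that are constant on `S`. -/
def constantsOn {X : Type*} (S : Set X) : Submodule ℂ (X → ℂ) where
  carrier := {f | ∀ x ∈ S, ∀ y ∈ S, f x = f y}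
  add_mem' hf hg x hx y hy := congrArg₂ (· + ·) (hf x hx y hy) (hg x hx y hy)
  zero_mem' _ _ _ _ := rfl
  smul_mem' c _ hf x hx y hy := congrArg (c * ·) (hf x hx y hy)

theorem mem_constantsOn_of_eq_zero {X : Type*} {S : Set X} {f : X → ℂ} (h : ∀ x ∈ S, f x = 0) :
    f ∈ constantsOn S :=
  fun x hx y hy => (h x hx).trans (h y hy).symm

theorem sum_offDiag_eq_sub {ι M : Type*} [Fintype ι] [AddCommGroup M] (f : ι × ι → M) :
    ∑ p ∈ Finset.univ.offDiag, f p = ∑ i, ∑ j, f (i, j) - ∑ i, f (i, i) := by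
  classical
  rw [eq_sub_iff_add_eq', ← Finset.sum_diag Finset.univ f,
    ← Finset.sum_union Finset.univ.disjoint_diag_offDiag, Finset.diag_union_offDiag,
    Finset.sum_product]

theorem exists_mem_ae_eq_of_mem_span {X : Type*} [MeasurableSpace X] {μ : Measure X}
    {S : Set (Lp ℂ 2 μ)} {F : Submodule ℂ (X → ℂ)} (h : ∀ φ ∈ S, ∃ f ∈ F, φ =ᵐ[μ] f)
    {φ : Lp ℂ 2 μ} (hφ : φ ∈ Submodule.span ℂ S) : ∃ f ∈ F, φ =ᵐ[μ] f := by
  induction hφ using Submodule.span_induction with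
  | mem φ hφ => exact h φ hφ
  | zero => exact ⟨0, zero_mem F, Lp.coeFn_zero _ _ _⟩
  | add φ ψ _ _ hφ hψ =>
    obtain ⟨f, hf, hφf⟩ := hφ
    obtain ⟨g, hg, hψg⟩ := hψ
    exact ⟨f + g, add_mem hf hg, (Lp.coeFn_add φ ψ).trans (hφf.add hψg)⟩
  | smul c φ _ hφ =>
    obtain ⟨f, hf, hφf⟩ := hφ
    exact ⟨c • f, F.smul_mem c hf, (Lp.coeFn_smul c φ).trans (hφf.const_smul c)⟩

namespace KGraph

variable {k : ℕ} {Λ : KGraph.{u} k} [NeZero k] [Λ.IsFinite] {δ : ℝ}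

/-! ## The measures on the spaces of choice functions -/

theorem choicePairs_eq (hw : Λ.WeightEqDiam δ) (γ : Λ.bratteli.FinPath) :
    Λ.choicePairs δ γ = ⋃ p ∈ (Finset.univ : Finset γ.Ext).offDiag,
      pathCylinder (γ.snoc p.1.2) ×ˢ pathCylinder (γ.snoc p.2.2) := by
  ext ⟨x, y⟩
  simp only [Set.mem_iUnion, exists_prop, Finset.mem_offDiag, Finset.mem_univ, true_and]
  constructor
  · rintro ⟨hx, hy, hd⟩
    obtain ⟨e, hx⟩ := exists_mem_pathCylinder_snoc hx
    obtain ⟨e', hy⟩ := exists_mem_pathCylinder_snoc hy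
    refine ⟨(e, e'), fun (h : e = e') => ?_, hx, hy⟩
    subst h
    rw [← hw.eq_diam] at hd
    exact ((BratteliDiagram.dist_le_of_mem_cylinder hw.isWeight hx hy).trans_lt
      (BratteliDiagram.weight_snoc_lt hw.isWeight γ e)).ne hd
  · rintro ⟨⟨e, e'⟩, hne, hx, hy⟩
    refine ⟨pathCylinder_snoc_subset γ e hx, pathCylinder_snoc_subset γ e' hy, ?_⟩
    rw [← hw.eq_diam]
    exact BratteliDiagram.dist_eq_of_mem_cylinder_snoc hne hx hy

theorem measurableSet_choicePairs (hw : Λ.WeightEqDiam δ) (γ : Λ.bratteli.FinPath) :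
    MeasurableSet (Λ.choicePairs δ γ) := by
  rw [choicePairs_eq hw]
  exact Finset.measurableSet_biUnion _ fun p _ =>
    (measurableSet_pathCylinder _).prod (measurableSet_pathCylinder _)

theorem setIntegral_choicePairs (hw : Λ.WeightEqDiam δ) (γ : Λ.bratteli.FinPath)
    {F : Λ.InfPath × Λ.InfPath → ℂ} (hF : Integrable F (Λ.measure.prod Λ.measure)) :
    ∫ p in Λ.choicePairs δ γ, F p ∂(Λ.measure.prod Λ.measure) =
      ∑ p ∈ (Finset.univ : Finset γ.Ext).offDiag,
        ∫ z in pathCylinder (γ.snoc p.1.2) ×ˢ pathCylinder (γ.snoc p.2.2),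
          F z ∂(Λ.measure.prod Λ.measure) := by
  have hd : Set.Pairwise ((Finset.univ : Finset γ.Ext).offDiag : Set (γ.Ext × γ.Ext))
      (Function.onFun Disjoint
        fun p => pathCylinder (γ.snoc p.1.2) ×ˢ pathCylinder (γ.snoc p.2.2)) :=
    fun _ _ _ _ hne => Set.disjoint_left.2 fun _ hz hz' => hne
      (Prod.ext (ext_eq_of_mem_pathCylinder hz.1 hz'.1) (ext_eq_of_mem_pathCylinder hz.2 hz'.2))
  rw [choicePairs_eq hw, integral_biUnion_finset _
    (fun p _ => (measurableSet_pathCylinder _).prod (measurableSet_pathCylinder _)) hd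
    fun p _ => hF.integrableOn]

theorem measure_choicePairs_ne_zero (hw : Λ.WeightEqDiam δ)
    (hpos : ∀ γ : Λ.bratteli.FinPath, 0 < mass γ) (γ : Λ.bratteli.FinPath) :
    (Λ.measure.prod Λ.measure) (Λ.choicePairs δ γ) ≠ 0 := by
  obtain ⟨e, e', hne⟩ := BratteliDiagram.exists_ext_ne hw.isWeight (hw.eq_diam γ)
  have hsub : pathCylinder (γ.snoc e.2) ×ˢ pathCylinder (γ.snoc e'.2) ⊆ Λ.choicePairs δ γ := by
    rw [choicePairs_eq hw]
    exact Set.subset_biUnion_of_mem (u := fun p : γ.Ext × γ.Ext =>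
      pathCylinder (γ.snoc p.1.2) ×ˢ pathCylinder (γ.snoc p.2.2)) (x := (e, e'))
      (Finset.mem_offDiag.2 ⟨Finset.mem_univ e, Finset.mem_univ e', hne⟩)
  have hm (η : Λ.bratteli.FinPath) : Λ.measure (pathCylinder η) ≠ 0 :=
    (ENNReal.toReal_pos_iff.1 (hpos η)).1.ne'
  refine fun h0 => mul_ne_zero (hm (γ.snoc e.2)) (hm (γ.snoc e'.2)) ?_
  rw [← Measure.prod_prod]
  exact measure_mono_null hsub h0

theorem isProbabilityMeasure_choiceMeasureAt (hw : Λ.WeightEqDiam δ)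
    (hpos : ∀ γ : Λ.bratteli.FinPath, 0 < mass γ) (γ : Λ.bratteli.FinPath) :
    IsProbabilityMeasure (Λ.choiceMeasureAt δ γ) :=
  ProbabilityTheory.cond_isProbabilityMeasure (measure_choicePairs_ne_zero hw hpos γ)

theorem measurePreserving_eval_choiceMeasure (hw : Λ.WeightEqDiam δ)
    (hpos : ∀ γ : Λ.bratteli.FinPath, 0 < mass γ) (γ : Λ.bratteli.FinPath) :
    MeasurePreserving (Function.eval γ) (Λ.choiceMeasure δ) (Λ.choiceMeasureAt δ γ) := by
  have hprob := isProbabilityMeasure_choiceMeasureAt hw hpos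
  rw [choiceMeasure, dif_pos hprob]
  exact measurePreserving_eval_infinitePi _ γ

/-! ## The Dirichlet form -/

theorem indicator_mem_formDomain (γ : Λ.bratteli.FinPath) :
    (pathCylinder γ).indicator (1 : Λ.InfPath → ℂ) ∈ Λ.formDomain :=
  Submodule.subset_span ⟨γ, rfl⟩

theorem isBoundedMeasurable_of_mem_formDomain {f : Λ.InfPath → ℂ} (hf : f ∈ Λ.formDomain) :
    IsBoundedMeasurable f := by
  induction hf using Submodule.span_induction with
  | mem f hf =>
    obtain ⟨γ, rfl⟩ := hf
    refine ⟨measurable_const.indicator (measurableSet_pathCylinder γ), 1, fun x => ?_⟩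
    exact (norm_indicator_le_norm_self _ _).trans norm_one.le
  | zero => exact .const 0
  | add f g _ _ hf hg => exact hf.add hg
  | smul c f _ hf => exact (IsBoundedMeasurable.const c).mul hf

variable (Λ δ) in
/-- The scalar `diam [γ]^(s - 2)` by which the block at `γ` enters the Dirichlet form, as it appears
in the trace of the block. -/
noncomputable def blockFactor (s : ℝ) (γ : Λ.bratteli.FinPath) : ℝ :=
  BratteliDiagram.diam (Λ.weight δ) γ ^ s * (1 / BratteliDiagram.diam (Λ.weight δ) γ) ^ 2

theorem trace_block (s : ℝ) (τ : Λ.bratteli.FinPath → Λ.InfPath × Λ.InfPath)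
    (g f : Λ.InfPath → ℂ) (γ : Λ.bratteli.FinPath) :
    (Λ.absDiracBlock δ s γ * (Λ.commutatorBlock δ τ g γ).conjTranspose *
      Λ.commutatorBlock δ τ f γ).trace
      = 2 * (Λ.blockFactor δ s γ : ℂ) * differenceProduct g f (τ γ) := by
  simp only [absDiracBlock, commutatorBlock, diracBlock, reprBlock, blockFactor,
    differenceProduct]
  generalize BratteliDiagram.diam (Λ.weight δ) γ ^ s = a
  generalize (1 / BratteliDiagram.diam (Λ.weight δ) γ) = b
  simp only [Matrix.trace_fin_two, Matrix.mul_apply, Fin.sum_univ_two]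
  simp
  ring

/-- The contribution of the block at `γ` to the Dirichlet form, up to the factor `blockFactor`. -/
noncomputable def blockForm (δ : ℝ) (γ : Λ.bratteli.FinPath) (g f : Λ.InfPath → ℂ) : ℂ :=
  ∫ p, differenceProduct g f p ∂(Λ.choiceMeasureAt δ γ)

theorem blockForm_eq_zero (hw : Λ.WeightEqDiam δ) {γ : Λ.bratteli.FinPath} {f : Λ.InfPath → ℂ}
    (hf : f ∈ constantsOn (pathCylinder γ)) (g : Λ.InfPath → ℂ) : blockForm δ γ g f = 0 := by
  refine integral_eq_zero_of_ae ?_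
  filter_upwards [ProbabilityTheory.ae_cond_mem (measurableSet_choicePairs hw γ)] with p hp
  rw [differenceProduct, hf _ hp.1 _ hp.2.1, sub_self, mul_zero, Pi.zero_apply]

theorem ae_tsum_trace_block_eq (hw : Λ.WeightEqDiam δ)
    (hpos : ∀ γ : Λ.bratteli.FinPath, 0 < mass γ) {f : Λ.InfPath → ℂ} {n : ℕ}
    (hn : ∀ γ : Λ.bratteli.FinPath, n ≤ γ.len → f ∈ constantsOn (pathCylinder γ)) (s : ℝ)
    (g : Λ.InfPath → ℂ) : ∀ᵐ τ ∂(Λ.choiceMeasure δ), ∑' γ : Λ.bratteli.FinPath,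
      (Λ.absDiracBlock δ s γ * (Λ.commutatorBlock δ τ g γ).conjTranspose *
        Λ.commutatorBlock δ τ f γ).trace
      = ∑ γ ∈ (BratteliDiagram.finite_len_lt (B := Λ.bratteli) n).toFinset,
        2 * (Λ.blockFactor δ s γ : ℂ) * differenceProduct g f (τ γ) := by
  have hmem : ∀ᵐ τ ∂(Λ.choiceMeasure δ), ∀ γ, τ γ ∈ Λ.choicePairs δ γ :=
    ae_all_iff.2 fun γ =>
      (measurePreserving_eval_choiceMeasure hw hpos γ).quasiMeasurePreserving.ae
        (ProbabilityTheory.ae_cond_mem (measurableSet_choicePairs hw γ))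
  filter_upwards [hmem] with τ hτ
  simp only [trace_block]
  refine tsum_eq_sum fun γ hγ => ?_
  rw [Set.Finite.mem_toFinset, Set.mem_ofPred_eq, not_lt] at hγ
  rw [differenceProduct, hn γ hγ _ (hτ γ).1 _ (hτ γ).2.1, sub_self, mul_zero, mul_zero]

theorem dirichletForm_eq_sum (hw : Λ.WeightEqDiam δ)
    (hpos : ∀ γ : Λ.bratteli.FinPath, 0 < mass γ) {f g : Λ.InfPath → ℂ}
    (hf : IsBoundedMeasurable f) (hg : IsBoundedMeasurable g) {n : ℕ}
    (hn : ∀ γ : Λ.bratteli.FinPath, n ≤ γ.len → f ∈ constantsOn (pathCylinder γ)) (s : ℝ) :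
    Λ.dirichletForm δ s g f =
      ∑ γ ∈ (BratteliDiagram.finite_len_lt (B := Λ.bratteli) n).toFinset,
        (Λ.blockFactor δ s γ : ℂ) * blockForm δ γ g f := by
  have hprob := isProbabilityMeasure_choiceMeasureAt hw hpos
  have heval := measurePreserving_eval_choiceMeasure hw hpos
  have hgf := hg.differenceProduct hf
  have hint (γ : Λ.bratteli.FinPath) :
      Integrable (fun τ => 2 * (Λ.blockFactor δ s γ : ℂ) * differenceProduct g f (τ γ))
        (Λ.choiceMeasure δ) :=
    ((heval γ).integrable_comp_of_integrable (hgf.integrable _)).const_mul _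
  have hblock (γ : Λ.bratteli.FinPath) :
      ∫ τ, differenceProduct g f (τ γ) ∂(Λ.choiceMeasure δ) = blockForm δ γ g f := by
    rw [blockForm, ← (heval γ).map_eq, integral_map (heval γ).measurable.aemeasurable
      hgf.measurable.aestronglyMeasurable]
  rw [dirichletForm, integral_congr_ae (ae_tsum_trace_block_eq hw hpos hn s g),
    integral_finsetSum _ fun γ _ => hint γ, Finset.mul_sum]
  refine Finset.sum_congr rfl fun γ _ => ?_
  rw [integral_const_mul, hblock]
  ring

/-- The covariance of `f` and `g` on `[γ]`, multiplied by `M([γ])²`. -/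
noncomputable def cylinderCovariance (γ : Λ.bratteli.FinPath) (g f : Λ.InfPath → ℂ) : ℂ :=
  mass γ * (∫ x in pathCylinder γ, (starRingEnd ℂ) (g x) * f x ∂Λ.measure)
    - (∫ x in pathCylinder γ, (starRingEnd ℂ) (g x) ∂Λ.measure) *
      (∫ x in pathCylinder γ, f x ∂Λ.measure)

theorem setIntegral_eq_sum_ext (γ : Λ.bratteli.FinPath) {f : Λ.InfPath → ℂ}
    (hf : IsBoundedMeasurable f) : ∫ x in pathCylinder γ, f x ∂Λ.measure
      = ∑ e : γ.Ext, ∫ x in pathCylinder (γ.snoc e.2), f x ∂Λ.measure := by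
  rw [pathCylinder_eq_iUnion, integral_iUnion_fintype (fun e => measurableSet_pathCylinder _)
    (fun e e' h => disjoint_pathCylinder_snoc γ h) fun e => (hf.integrable _).integrableOn]

-- The sum over all pairs of extensions gives the covariance on `[γ]`; the diagonal, which does not
-- occur in the support of `N_γ`, accounts for the covariances on the `[γ e]`.
theorem blockForm_eq (hw : Λ.WeightEqDiam δ) (γ : Λ.bratteli.FinPath) {f g : Λ.InfPath → ℂ}
    (hf : IsBoundedMeasurable f) (hg : IsBoundedMeasurable g) :
    blockForm δ γ g f =
      ((Λ.measure.prod Λ.measure).real (Λ.choicePairs δ γ) : ℂ)⁻¹ * (2 *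
        (cylinderCovariance γ g f - ∑ e : γ.Ext, cylinderCovariance (γ.snoc e.2) g f)) := by
  rw [blockForm, choiceMeasureAt, ProbabilityTheory.cond, integral_smul_measure,
    ENNReal.toReal_inv, Complex.real_smul, Complex.ofReal_inv, ← Measure.real,
    setIntegral_choicePairs hw γ ((hg.differenceProduct hf).integrable _), sum_offDiag_eq_sub]
  congr 1
  simp only [← Measure.prod_restrict, integral_differenceProduct_prod _ _ hg hf,
    measureReal_restrict_apply_univ, ← mass.eq_1]
  simp only [Finset.sum_sub_distrib, Finset.sum_add_distrib, ← Finset.mul_sum, ← Finset.sum_mul,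
    cylinderCovariance, ← setIntegral_eq_sum_ext γ hf, ← setIntegral_eq_sum_ext γ hg.conj,
    ← setIntegral_eq_sum_ext γ (hg.conj.mul hf), ← Complex.ofReal_sum, sum_mass_snoc]
  simp only [mul_comm]
  ring

theorem cylinderCovariance_eq_zero {γ : Λ.bratteli.FinPath} {f : Λ.InfPath → ℂ}
    (hf : f ∈ constantsOn (pathCylinder γ)) (g : Λ.InfPath → ℂ) :
    cylinderCovariance γ g f = 0 := by
  have hm := measurableSet_pathCylinder γ
  rcases (pathCylinder γ).eq_empty_or_nonempty with hempty | ⟨y, hy⟩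
  · rw [cylinderCovariance, hempty, setIntegral_empty, setIntegral_empty, mul_zero, zero_mul,
      sub_zero]
  · rw [cylinderCovariance, setIntegral_congr_fun hm fun x hx => hf x hx y hy,
      setIntegral_congr_fun (g := fun x => (starRingEnd ℂ) (g x) * f y) hm
        fun x hx => congrArg _ (hf x hx y hy),
      integral_mul_const, setIntegral_const, Complex.real_smul, mass]
    ring

theorem cylinderCovariance_of_integral_eq_zero {γ : Λ.bratteli.FinPath} {f : Λ.InfPath → ℂ}
    (hsupp : ∀ x ∉ pathCylinder γ, f x = 0) (hint : ∫ x, f x ∂Λ.measure = 0)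
    (g : Λ.InfPath → ℂ) : cylinderCovariance γ g f =
      mass γ * ∫ x, (starRingEnd ℂ) (g x) * f x ∂Λ.measure := by
  rw [cylinderCovariance, setIntegral_eq_integral_of_forall_compl_eq_zero hsupp, hint, mul_zero,
    sub_zero, setIntegral_eq_integral_of_forall_compl_eq_zero fun x hx => by
      rw [hsupp x hx, mul_zero]]


/-! ## Haar functions -/

/-- A Haar function at `γ`: a function on `[γ]` of mean zero that depends on the first edge after
`γ` only. These functions represent the elements of `E_γ`. -/
structure IsHaarFunction (γ : Λ.bratteli.FinPath) (f : Λ.InfPath → ℂ) : Prop where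
  mem_formDomain : f ∈ Λ.formDomain
  eq_zero : ∀ x ∉ pathCylinder γ, f x = 0
  mem_constantsOn : ∀ e : γ.Ext, f ∈ constantsOn (pathCylinder (γ.snoc e.2))
  integral : ∫ x, f x ∂Λ.measure = 0

/-- The space of Haar functions at `γ`. -/
def haarSpace (γ : Λ.bratteli.FinPath) : Submodule ℂ (Λ.InfPath → ℂ) where
  carrier := {f | IsHaarFunction γ f}
  add_mem' {f g} hf hg := by
    have hint {h : Λ.InfPath → ℂ} (hh : IsHaarFunction γ h) : Integrable h Λ.measure :=
      (isBoundedMeasurable_of_mem_formDomain hh.mem_formDomain).integrable _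
    refine ⟨add_mem hf.mem_formDomain hg.mem_formDomain, fun x hx => ?_,
      fun e => add_mem (hf.mem_constantsOn e) (hg.mem_constantsOn e), ?_⟩
    · rw [Pi.add_apply, hf.eq_zero x hx, hg.eq_zero x hx, add_zero]
    · exact (integral_add (hint hf) (hint hg)).trans (by rw [hf.integral, hg.integral, add_zero])
  zero_mem' := ⟨zero_mem _, fun _ _ => rfl, fun _ => zero_mem _, integral_zero _ _⟩
  smul_mem' c f hf := by
    refine ⟨Submodule.smul_mem _ c hf.mem_formDomain, fun x hx => ?_,
      fun e => Submodule.smul_mem _ c (hf.mem_constantsOn e), ?_⟩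
    · rw [Pi.smul_apply, hf.eq_zero x hx, smul_zero]
    · exact (integral_smul c f).trans (by rw [hf.integral, smul_zero])

theorem chiPath_ae_eq (γ : Λ.bratteli.FinPath) :
    chiPath γ =ᵐ[Λ.measure] (pathCylinder γ).indicator (1 : Λ.InfPath → ℂ) :=
  indicatorConstLp_coeFn (hs := measurableSet_pathCylinder γ) (hμs := measure_ne_top _ _)

theorem chiNormalized_sub_ae_eq (γ η : Λ.bratteli.FinPath) :
    (chiNormalized γ - chiNormalized η : Λ.L2) =ᵐ[Λ.measure]
      (mass γ : ℂ)⁻¹ • (pathCylinder γ).indicator (1 : Λ.InfPath → ℂ)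
        - (mass η : ℂ)⁻¹ • (pathCylinder η).indicator (1 : Λ.InfPath → ℂ) := by
  have h (ξ : Λ.bratteli.FinPath) : chiNormalized ξ =ᵐ[Λ.measure]
      (mass ξ : ℂ)⁻¹ • (pathCylinder ξ).indicator (1 : Λ.InfPath → ℂ) :=
    (Lp.coeFn_smul _ _).trans ((chiPath_ae_eq ξ).const_smul _)
  exact (Lp.coeFn_sub _ _).trans ((h γ).sub (h η))

theorem integral_normalized_indicator {γ : Λ.bratteli.FinPath} (hγ : 0 < mass γ) :
    ∫ x, ((mass γ : ℂ)⁻¹ • (pathCylinder γ).indicator (1 : Λ.InfPath → ℂ)) x ∂Λ.measure = 1 := by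
  simp only [Pi.smul_apply]
  rw [integral_smul, integral_indicator (measurableSet_pathCylinder γ)]
  simp only [Pi.one_apply, setIntegral_const, smul_eq_mul, Complex.real_smul, mul_one]
  exact inv_mul_cancel₀ (Complex.ofReal_ne_zero.2 hγ.ne')

theorem indicator_mem_constantsOn {γ η : Λ.bratteli.FinPath} (h : γ.len ≤ η.len) :
    (pathCylinder γ).indicator (1 : Λ.InfPath → ℂ) ∈ constantsOn (pathCylinder η) := by
  rcases pathCylinder_subset_or_disjoint h with h | h
  · intro x hx y hy
    rw [Set.indicator_of_mem (h hx), Set.indicator_of_mem (h hy), Pi.one_apply, Pi.one_apply]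
  · exact mem_constantsOn_of_eq_zero fun x hx =>
      Set.indicator_of_notMem (Set.disjoint_left.1 h hx) _

theorem isHaarFunction_normalized_indicator_sub (hpos : ∀ γ : Λ.bratteli.FinPath, 0 < mass γ)
    {γ : Λ.bratteli.FinPath} (e e' : γ.Ext) : IsHaarFunction γ
      ((mass (γ.snoc e.2) : ℂ)⁻¹ •
          (pathCylinder (γ.snoc e.2)).indicator (1 : Λ.InfPath → ℂ)
        - (mass (γ.snoc e'.2) : ℂ)⁻¹ •
          (pathCylinder (γ.snoc e'.2)).indicator (1 : Λ.InfPath → ℂ)) := by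
  have hmem (a : γ.Ext) := Submodule.smul_mem _ (mass (γ.snoc a.2) : ℂ)⁻¹
    (indicator_mem_formDomain (γ.snoc a.2))
  have hint (a : γ.Ext) := (isBoundedMeasurable_of_mem_formDomain (hmem a)).integrable Λ.measure
  have hzero (a : γ.Ext) {x : Λ.InfPath} (hx : x ∉ pathCylinder γ) :
      (pathCylinder (γ.snoc a.2)).indicator (1 : Λ.InfPath → ℂ) x = 0 :=
    Set.indicator_of_notMem (fun h => hx (pathCylinder_snoc_subset γ a h)) _
  refine ⟨sub_mem (hmem e) (hmem e'), fun x hx => ?_, fun a => ?_, ?_⟩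
  · rw [Pi.sub_apply, Pi.smul_apply, Pi.smul_apply, hzero e hx, hzero e' hx, smul_zero, smul_zero,
      sub_zero]
  · have hconst (b : γ.Ext) := Submodule.smul_mem _ (mass (γ.snoc b.2) : ℂ)⁻¹
      (indicator_mem_constantsOn (γ := γ.snoc b.2) (η := γ.snoc a.2) le_rfl)
    exact sub_mem (hconst e) (hconst e')
  · refine (integral_sub (hint e) (hint e')).trans ?_
    rw [integral_normalized_indicator (hpos _), integral_normalized_indicator (hpos _), sub_self]

theorem exists_mem_haarSpace_of_mem_eigenspacePath
    (hpos : ∀ γ : Λ.bratteli.FinPath, 0 < mass γ) {γ : Λ.bratteli.FinPath} {φ : Λ.L2}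
    (hφ : φ ∈ Λ.eigenspacePath γ) : ∃ f ∈ haarSpace γ, φ =ᵐ[Λ.measure] f := by
  refine exists_mem_ae_eq_of_mem_span ?_ hφ
  rintro _ ⟨e, e', -, rfl⟩
  exact ⟨_, isHaarFunction_normalized_indicator_sub hpos e e', chiNormalized_sub_ae_eq _ _⟩

namespace IsHaarFunction

variable {γ η : Λ.bratteli.FinPath} {f g : Λ.InfPath → ℂ}

theorem isBoundedMeasurable (hf : IsHaarFunction γ f) : IsBoundedMeasurable f :=
  isBoundedMeasurable_of_mem_formDomain hf.mem_formDomain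

theorem mem_constantsOn_of_disjoint (hf : IsHaarFunction γ f)
    (h : Disjoint (pathCylinder γ) (pathCylinder η)) : f ∈ constantsOn (pathCylinder η) :=
  mem_constantsOn_of_eq_zero fun x hx => hf.eq_zero x (Set.disjoint_right.1 h hx)

theorem mem_constantsOn_of_len_lt (hf : IsHaarFunction γ f) (h : γ.len < η.len) :
    f ∈ constantsOn (pathCylinder η) := by
  rcases pathCylinder_subset_or_disjoint h.le with hsub | hdisj
  · intro x hx y hy
    obtain ⟨e, he⟩ := exists_mem_pathCylinder_snoc (hsub hx)
    have hsub' := (pathCylinder_subset_or_disjoint (γ := γ.snoc e.2) h).resolve_right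
      (Set.not_disjoint_iff.2 ⟨x, hx, he⟩)
    exact hf.mem_constantsOn e x he y (hsub' hy)
  · exact hf.mem_constantsOn_of_disjoint hdisj.symm

theorem cylinderCovariance_of_subset (hf : IsHaarFunction γ f)
    (h : pathCylinder γ ⊆ pathCylinder η) (g : Λ.InfPath → ℂ) :
    cylinderCovariance η g f = mass η * ∫ x, (starRingEnd ℂ) (g x) * f x ∂Λ.measure :=
  cylinderCovariance_of_integral_eq_zero (fun x hx => hf.eq_zero x fun hx' => hx (h hx'))
    hf.integral g

theorem blockForm_self (hw : Λ.WeightEqDiam δ) (hf : IsHaarFunction γ f)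
    (hg : IsBoundedMeasurable g) : blockForm δ γ g f =
      ((((Λ.measure.prod Λ.measure).real (Λ.choicePairs δ γ))⁻¹ * (2 * mass γ) : ℝ) : ℂ) *
        ∫ x, (starRingEnd ℂ) (g x) * f x ∂Λ.measure := by
  rw [blockForm_eq hw γ hf.isBoundedMeasurable hg, hf.cylinderCovariance_of_subset subset_rfl,
    Finset.sum_eq_zero fun e _ => cylinderCovariance_eq_zero (hf.mem_constantsOn e) g]
  push_cast
  ring

theorem blockForm_of_subset (hw : Λ.WeightEqDiam δ) {a : η.Ext}
    (ha : pathCylinder γ ⊆ pathCylinder (η.snoc a.2)) (hf : IsHaarFunction γ f)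
    (hg : IsBoundedMeasurable g) : blockForm δ η g f =
      ((((Λ.measure.prod Λ.measure).real (Λ.choicePairs δ η))⁻¹ *
        (2 * (mass η - mass (η.snoc a.2))) : ℝ) : ℂ) *
        ∫ x, (starRingEnd ℂ) (g x) * f x ∂Λ.measure := by
  have hne (e : η.Ext) (he : e ≠ a) : cylinderCovariance (η.snoc e.2) g f = 0 :=
    cylinderCovariance_eq_zero (hf.mem_constantsOn_of_disjoint
      ((disjoint_pathCylinder_snoc η he.symm).mono_left ha)) g
  rw [blockForm_eq hw η hf.isBoundedMeasurable hg,
    Fintype.sum_eq_single a hne, hf.cylinderCovariance_of_subset ha,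
    hf.cylinderCovariance_of_subset (ha.trans (pathCylinder_snoc_subset η a))]
  push_cast
  ring

end IsHaarFunction

theorem exists_blockForm_eq (hw : Λ.WeightEqDiam δ) (γ η : Λ.bratteli.FinPath) :
    ∃ c : ℝ, ∀ f g : Λ.InfPath → ℂ, IsHaarFunction γ f → IsBoundedMeasurable g →
      blockForm δ η g f = c * ∫ x, (starRingEnd ℂ) (g x) * f x ∂Λ.measure := by
  have hzero (h : ∀ f, IsHaarFunction γ f → f ∈ constantsOn (pathCylinder η)) :
      ∃ c : ℝ, ∀ f g : Λ.InfPath → ℂ, IsHaarFunction γ f → IsBoundedMeasurable g →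
        blockForm δ η g f = c * ∫ x, (starRingEnd ℂ) (g x) * f x ∂Λ.measure :=
    ⟨0, fun f g hf _ => by
      rw [blockForm_eq_zero hw (h f hf), Complex.ofReal_zero, zero_mul]⟩
  by_cases hdisj : Disjoint (pathCylinder γ) (pathCylinder η)
  · exact hzero fun f hf => hf.mem_constantsOn_of_disjoint hdisj
  obtain ⟨x, hxγ, hxη⟩ := Set.not_disjoint_iff.1 hdisj
  rcases lt_trichotomy γ.len η.len with hlt | heq | hgt
  · exact hzero fun f hf => hf.mem_constantsOn_of_len_lt hlt
  · obtain rfl : γ = η := by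
      by_contra hne
      exact hdisj (disjoint_pathCylinder heq hne)
    exact ⟨_, fun f g hf hg => hf.blockForm_self hw hg⟩
  · obtain ⟨a, ha⟩ := exists_mem_pathCylinder_snoc hxη
    have hsub := (pathCylinder_subset_or_disjoint (γ := η.snoc a.2) hgt).resolve_right
      (Set.not_disjoint_iff.2 ⟨x, hxγ, ha⟩)
    exact ⟨_, fun f g hf hg => hf.blockForm_of_subset hw hsub hg⟩

/-! ## The eigenspaces of the Laplace–Beltrami operators -/

theorem consistsOfEigenvectors_of_blockForm_eq (hw : Λ.WeightEqDiam δ)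
    (hpos : ∀ γ : Λ.bratteli.FinPath, 0 < mass γ) (s : ℝ) {E : Submodule ℂ Λ.L2}
    {F : Submodule ℂ (Λ.InfPath → ℂ)} (hEF : ∀ φ ∈ E, ∃ f ∈ F, φ =ᵐ[Λ.measure] f)
    (hF : F ≤ Λ.formDomain) {n : ℕ}
    (hn : ∀ f ∈ F, ∀ γ : Λ.bratteli.FinPath, n ≤ γ.len → f ∈ constantsOn (pathCylinder γ))
    {c : Λ.bratteli.FinPath → ℝ}
    (hc : ∀ γ, ∀ f ∈ F, ∀ g, IsBoundedMeasurable g →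
      blockForm δ γ g f = c γ * ∫ x, (starRingEnd ℂ) (g x) * f x ∂Λ.measure) :
    Λ.ConsistsOfEigenvectors δ s E := by
  set b : ℝ := ∑ γ ∈ (BratteliDiagram.finite_len_lt (B := Λ.bratteli) n).toFinset,
    Λ.blockFactor δ s γ * c γ with hb
  refine ⟨b, fun φ hφ => ?_⟩
  obtain ⟨f, hf, hφf⟩ := hEF φ hφ
  refine ⟨f, hF hf, hφf, fun g hg => ?_⟩
  have hg' := isBoundedMeasurable_of_mem_formDomain hg
  have hae : (((b : ℂ) • φ : Λ.L2) : Λ.InfPath → ℂ) =ᵐ[Λ.measure] (b : ℂ) • f :=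
    (Lp.coeFn_smul _ _).trans (hφf.const_smul _)
  calc ∫ x, (starRingEnd ℂ) (g x) * ((b : ℂ) • φ : Λ.L2) x ∂Λ.measure
      = ∫ x, b * ((starRingEnd ℂ) (g x) * f x) ∂Λ.measure := by
        refine integral_congr_ae ?_
        filter_upwards [hae] with x hx
        rw [hx, Pi.smul_apply, smul_eq_mul, mul_left_comm]
    _ = b * ∫ x, (starRingEnd ℂ) (g x) * f x ∂Λ.measure := integral_const_mul _ _
    _ = Λ.dirichletForm δ s g f := by
        rw [dirichletForm_eq_sum hw hpos (isBoundedMeasurable_of_mem_formDomain (hF hf)) hg'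
          (hn f hf) s, hb, Complex.ofReal_sum, Finset.sum_mul]
        simp only [hc _ f hf g hg', Complex.ofReal_mul, mul_assoc]

theorem consistsOfEigenvectors_eigenspacePath (hw : Λ.WeightEqDiam δ)
    (hpos : ∀ γ : Λ.bratteli.FinPath, 0 < mass γ) (s : ℝ) (γ : Λ.bratteli.FinPath) :
    Λ.ConsistsOfEigenvectors δ s (Λ.eigenspacePath γ) := by
  choose c hc using exists_blockForm_eq hw γ
  exact consistsOfEigenvectors_of_blockForm_eq hw hpos s (F := haarSpace γ)
    (fun φ hφ => exists_mem_haarSpace_of_mem_eigenspacePath hpos hφ)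
    (fun f hf => hf.mem_formDomain) (fun f hf η hη => hf.mem_constantsOn_of_len_lt hη)
    (fun η f hf g hg => hc η f g hf hg)

theorem consistsOfEigenvectors_of_le_scalingSpace_zero (hw : Λ.WeightEqDiam δ)
    (hpos : ∀ γ : Λ.bratteli.FinPath, 0 < mass γ) (s : ℝ) {E : Submodule ℂ Λ.L2}
    (hE : E ≤ Λ.scalingSpace 0) : Λ.ConsistsOfEigenvectors δ s E := by
  let F := Λ.formDomain ⊓ ⨅ γ : Λ.bratteli.FinPath, constantsOn (pathCylinder γ)
  have hF {f : Λ.InfPath → ℂ} (hf : f ∈ F) (γ : Λ.bratteli.FinPath) :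
      f ∈ constantsOn (pathCylinder γ) := (Submodule.mem_iInf _).1 hf.2 γ
  rw [scalingSpace_eq_levelSpace, zero_mul] at hE
  refine consistsOfEigenvectors_of_blockForm_eq hw hpos s (F := F) (n := 0) (c := 0)
    (fun φ hφ => exists_mem_ae_eq_of_mem_span ?_ (hE hφ)) inf_le_left
    (fun f hf γ _ => hF hf γ) fun γ f hf g _ => ?_
  · rintro _ ⟨γ, hγ, rfl⟩
    exact ⟨_, ⟨indicator_mem_formDomain γ, (Submodule.mem_iInf _).2 fun η =>
      indicator_mem_constantsOn (hγ.trans_le η.len.zero_le)⟩, chiPath_ae_eq γ⟩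
  · rw [blockForm_eq_zero hw (hF hf γ), Pi.zero_apply, Complex.ofReal_zero, zero_mul]

end KGraph

theorem theorem4p6_general {k : ℕ} [NeZero k] (Λ : KGraph.{u} k) [Λ.IsFinite]
    (hperron : ∃ x, Λ.IsPerronFrobenius x) (δ : ℝ) (hw : Λ.WeightEqDiam δ) :
    (Λ.IsPerronFrobenius Λ.perron ∧ Λ.IsPathMeasure Λ.measure) ∧
    ((∀ n, Λ.scalingSpace 0 ⟂ Λ.waveletSpace n) ∧
      (∀ m n, m ≠ n → Λ.waveletSpace m ⟂ Λ.waveletSpace n) ∧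
      (Λ.scalingSpace 0 ⊔ ⨆ n, Λ.waveletSpace n).topologicalClosure = ⊤) ∧
    (∀ s : ℝ, Λ.ConsistsOfEigenvectors δ s Λ.eigenspaceConst ∧
      Λ.ConsistsOfEigenvectors δ s Λ.eigenspaceRoot ∧
      ∀ γ : Λ.bratteli.FinPath, Λ.ConsistsOfEigenvectors δ s (Λ.eigenspacePath γ)) ∧
    (Λ.eigenspaceConst ⟂ Λ.eigenspaceRoot ∧
      Λ.scalingSpace 0 = Λ.eigenspaceConst ⊔ Λ.eigenspaceRoot) ∧
    (∀ γ η : Λ.bratteli.FinPath, γ ≠ η → Λ.eigenspacePath γ ⟂ Λ.eigenspacePath η) ∧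
    (∀ n : ℕ, Λ.waveletSpace n =
      ⨆ γ ∈ {γ : Λ.bratteli.FinPath | n * k ≤ γ.len ∧ γ.len < (n + 1) * k},
        Λ.eigenspacePath γ) := by
  have hx := KGraph.isPerronFrobenius_perron hperron
  have hρ := hx.rho_pos fun γ =>
    (BratteliDiagram.exists_ext_ne hw.isWeight (hw.eq_diam γ)).nonempty
  have hM := KGraph.isPathMeasure_measure hperron hρ
  have hpos := KGraph.mass_pos hM hx hρ
  have hprob := hM.prob
  have hV0 := KGraph.scalingSpace_zero_eq hpos
  have heigen₀ (s : ℝ) {E : Submodule ℂ Λ.L2} (hE : E ≤ Λ.scalingSpace 0) :=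
    KGraph.consistsOfEigenvectors_of_le_scalingSpace_zero hw hpos s hE
  exact ⟨⟨hx, hM⟩,
    ⟨fun n => KGraph.scalingSpace_isOrtho_waveletSpace (Nat.zero_le n),
      fun m n => KGraph.waveletSpace_isOrtho, KGraph.topologicalClosure_eq_top hpos⟩,
    fun s => ⟨heigen₀ s (hV0 ▸ le_sup_left), heigen₀ s (hV0 ▸ le_sup_right),
      KGraph.consistsOfEigenvectors_eigenspacePath hw hpos s⟩,
    ⟨KGraph.eigenspaceConst_isOrtho_eigenspaceRoot hpos, hV0⟩,
    fun γ η => KGraph.eigenspacePath_isOrtho hpos, KGraph.waveletSpace_eq hpos⟩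

theorem theorem4p6 {k : ℕ} [NeZero k] (Λ : KGraph.{u} k) [Λ.IsFinite] [Nonempty Λ.Obj]
    (hconn : Λ.StronglyConnected) (hirr : Λ.adjProd.IsIrreducible)
    (δ : ℝ) (hδ : δ ∈ Set.Ioo (0 : ℝ) 1) (hw : Λ.WeightEqDiam δ) :
    -- `x^Λ` and `M` exist (the definitions of `perron` and `measure` do not take a default value)
    (Λ.IsPerronFrobenius Λ.perron ∧ Λ.IsPathMeasure Λ.measure) ∧
    -- the wavelet decomposition of `L²(Λ^∞, M)`
    ((∀ n, Λ.scalingSpace 0 ⟂ Λ.waveletSpace n) ∧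
      (∀ m n, m ≠ n → Λ.waveletSpace m ⟂ Λ.waveletSpace n) ∧
      (Λ.scalingSpace 0 ⊔ ⨆ n, Λ.waveletSpace n).topologicalClosure = ⊤) ∧
    -- the spaces `E_{-1}`, `E_0`, `E_γ` consist of eigenvectors of every `Δ_s`
    (∀ s : ℝ, Λ.ConsistsOfEigenvectors δ s Λ.eigenspaceConst ∧
      Λ.ConsistsOfEigenvectors δ s Λ.eigenspaceRoot ∧
      ∀ γ : Λ.bratteli.FinPath, Λ.ConsistsOfEigenvectors δ s (Λ.eigenspacePath γ)) ∧
    -- `𝒱_0 = E_{-1} ⊕ E_0`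
    (Λ.eigenspaceConst ⟂ Λ.eigenspaceRoot ∧
      Λ.scalingSpace 0 = Λ.eigenspaceConst ⊔ Λ.eigenspaceRoot) ∧
    -- `𝒲_n` is the orthogonal direct sum of the `E_γ` with `nk ≤ |γ| < (n+1)k`
    (∀ γ η : Λ.bratteli.FinPath, γ ≠ η → Λ.eigenspacePath γ ⟂ Λ.eigenspacePath η) ∧
    (∀ n : ℕ, Λ.waveletSpace n =
      ⨆ γ ∈ {γ : Λ.bratteli.FinPath | n * k ≤ γ.len ∧ γ.len < (n + 1) * k},
        Λ.eigenspacePath γ) := by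
  exact theorem4p6_general Λ (KGraph.exists_isPerronFrobenius hirr) δ hw
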